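/- **Conventions.** Let $n\ge 1$; cubes $Q\subset\mathbb R^n$ have sides parallel to the coordinate axes, and $|Q|$ is the volume of $Q$. A weight is a non-negative, locally integrable function on $\mathbb R^n$. A Young function is a convex, increasing, continuous $\Phi:[0,\infty)\to[0,\infty)$ with $\Phi(0)=0$ and $\Phi(t)/t\to\infty$ as $t\to\infty$; here "increasing" is understood in the weak sense. For $1<s<\infty$ write $s'=s/(s-1)$; $\Phi\in B_s$ means that $\Phi$ is a Young function with $\int_1^\infty \frac{\Phi(t)}{t^s}\frac{dt}{t}<\infty$. Put $$\|f\|_{\Phi,Q}=\inf\Big\{\lambda>0: \frac1{|Q|}\int_Q\Phi\big(|f|/\lambda\big)\,dx\le 1\Big\},\qquad [w]_{RH_\Phi}=\sup_Q\Big(\frac1{|Q|}\int_Q w\,dx\Big)^{-1}\|w\|_{\Phi,Q},$$ $$[w]_{RH_\infty}=\sup_Q\Big(\operatorname*{ess\,sup}_{Q}w\Big)\Big(\frac1{|Q|}\int_Q w\,dx\Big)^{-1}\qquad(\text{with } 0^{-1}\cdot 0=0),$$ and let $RH_\Phi$, $RH_\infty$ be the classes of weights for which the respective quantity is finite (for $RH_\Phi$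 the definition makes sense for any function $\Phi:[0,\infty)\to[0,\infty)$). Put $\|f\|_{L^p(w)}=(\int_{\mathbb R^n}f^p\,w\,dx)^{1/p}$. Let $\mathcal F$ be a family of pairs $(f,g)$ of non-negative measurable functions on $\mathbb R^n$ (the value $\infty$ is allowed). For $0<p<\infty$ and a class $RH_*$ as above, "$\|f\|_{L^p(w)}\lesssim\|g\|_{L^p(w)}$, $(f,g)\in\mathcal F$, for all $w\in RH_*$" means that there is a function $N:[0,\infty)\to[0,\infty)$ such that for every $K\ge 0$, every weight $w$ with $[w]_{RH_*}\le K$ and every $(f,g)\in\mathcal F$ with $\|f\|_{L^p(w)}<\infty$, $$\|f\|_{L^p(w)}\le N(K)\,\|g\|_{L^p(w)} .$$ **Theorem.** Let $0<p_0\le q_0<\infty$. If $p_0<q_0$, let $\Psi_0\in B_{(q_0/p_0)'}$ and suppose that $$\|f\|_{L^{p_0}(w)}\lesssim\|g\|_{L^{p_0}(w)},\qquad (f,g)\in\mathcal F,\tag{1}$$ for all $w\in RH_{\Psi_0}$. If $p_0=q_0$, suppose that (1) holds for all $w\in RH_\infty$. Then $$\|f\|_{L^{p}(w)}\lesssim\|g\|_{L^{p}(w)},\qquad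 (f,g)\in\mathcal F,$$ in each of the following cases: (a) $p_0<p<q_0$, for all $w\in RH_\Psi$, where $\Psi$ is defined on $[0,\infty)$ by $\Psi_0(t)=\Psi(t^r)$, $r=\dfrac{(q_0/p_0)'}{(q_0/p)'}$; (b) $p=q_0$, for all $w\in RH_\infty$. Moreover, the function $N'$ in the conclusion can be chosen to depend only on $n,p_0,q_0,p,\Psi_0$ and the function $N$ in the hypothesis, and not otherwise on $\mathcal F$. -/

import Mathlib

open MeasureTheory Set Filter
open scoped NNReal ENNReal Topology

noncomputable section

namespace RHExtrapolation

/-- The closed cube in `ℝⁿ` with sides parallel to the axes, lower corner `a` and side length `l`.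
Here `ℝⁿ` is `Fin n → ℝ` with its Lebesgue measure; no norm on it is ever used. -/
def cube {n : ℕ} (a : Fin n → ℝ) (l : ℝ) : Set (Fin n → ℝ) :=
  {x | ∀ i, a i ≤ x i ∧ x i ≤ a i + l}

/-- A Young function `[0,∞) → [0,∞)`. It is represented by a function on `ℝ`, of which only the
values on `[0,∞)` are ever used. -/
structure IsYoung (Φ : ℝ → ℝ) : Prop where
  nonneg : ∀ t, 0 ≤ t → 0 ≤ Φ t
  map_zero : Φ 0 = 0
  convex : ConvexOn ℝ (Ici 0) Φ
  mono : MonotoneOn Φ (Ici 0)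
  cont : ContinuousOn Φ (Ici 0)
  superlinear : Tendsto (fun t => Φ t / t) atTop atTop

/-- The class `B_s`, `1 < s < ∞`: Young functions `Φ` with `∫_1^∞ Φ(t) t^{-s} dt/t < ∞`. -/
structure MemB (s : ℝ) (Φ : ℝ → ℝ) : Prop where
  one_lt : 1 < s
  young : IsYoung Φ
  integrable : IntegrableOn (fun t => Φ t / t ^ s / t) (Ioi 1)

/-- The localized Orlicz (Luxemburg) norm
`‖f‖_{Φ,Q} = inf {c > 0 : ⨍_Q Φ(|f|/c) ≤ 1}`, equal to `∞` if there is no such `c`. -/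
def orliczNorm {n : ℕ} (Φ : ℝ → ℝ) (Q : Set (Fin n → ℝ)) (f : (Fin n → ℝ) → ℝ) : ℝ≥0∞ :=
  ⨅ (c : ℝ) (_ : 0 < c ∧ ⨍⁻ x in Q, ENNReal.ofReal (Φ (|f x| / c)) ∂volume ≤ 1),
    ENNReal.ofReal c

/-- A weight: a non-negative locally integrable function on `ℝⁿ`. -/
structure IsWeight {n : ℕ} (w : (Fin n → ℝ) → ℝ) : Prop where
  nonneg : ∀ x, 0 ≤ w x
  locInt : LocallyIntegrable w volume

/-- The characteristic `[w]_{RH_Φ} = sup_Q (⨍_Q w)⁻¹ ‖w‖_{Φ,Q}`, where `0⁻¹ * 0 = 0`.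
A weight `w` belongs to `RH_Φ` when this is finite. -/
def rhConst {n : ℕ} (Φ : ℝ → ℝ) (w : (Fin n → ℝ) → ℝ) : ℝ≥0∞ :=
  ⨆ (a : Fin n → ℝ) (l : ℝ) (_ : 0 < l),
    (⨍⁻ x in cube a l, ENNReal.ofReal (w x) ∂volume)⁻¹ * orliczNorm Φ (cube a l) w

/-- The characteristic `[w]_{RH_∞} = sup_Q (ess sup_Q w) (⨍_Q w)⁻¹`, where `0 * 0⁻¹ = 0`.
A weight `w` belongs to `RH_∞` when this is finite. -/
def rhInftyConst {n : ℕ} (w : (Fin n → ℝ) → ℝ) : ℝ≥0∞ :=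
  ⨆ (a : Fin n → ℝ) (l : ℝ) (_ : 0 < l),
    essSup (fun x => ENNReal.ofReal (w x)) (volume.restrict (cube a l)) *
      (⨍⁻ x in cube a l, ENNReal.ofReal (w x) ∂volume)⁻¹

/-- `‖f‖_{L^p(w)} = (∫ f^p w dx)^{1/p}` for `0 < p < ∞` and a non-negative function `f`. -/
def lpNorm {n : ℕ} (p : ℝ) (w : (Fin n → ℝ) → ℝ) (f : (Fin n → ℝ) → ℝ≥0∞) : ℝ≥0∞ :=
  (∫⁻ x, f x ^ p * ENNReal.ofReal (w x) ∂volume) ^ (1 / p)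

/-- A family of pairs `(f, g)` of non-negative (Lebesgue) measurable functions. -/
def IsFamily {n : ℕ} (F : Set (((Fin n → ℝ) → ℝ≥0∞) × ((Fin n → ℝ) → ℝ≥0∞))) : Prop :=
  ∀ fg ∈ F, AEMeasurable fg.1 volume ∧ AEMeasurable fg.2 volume

/-- The inequality `‖f‖_{L^p(w)} ≲ ‖g‖_{L^p(w)}`, `(f, g) ∈ F`, for all weights `w` of a class
given by a characteristic `char` (the weights with `char w < ∞`). It is required for the pairs with
finite left-hand side. The constant depends on `w` only through (a bound for) its characteristic:
it is `N K` for all weights with `char w ≤ K`. -/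
def NormIneq {n : ℕ} (F : Set (((Fin n → ℝ) → ℝ≥0∞) × ((Fin n → ℝ) → ℝ≥0∞))) (p : ℝ)
    (char : ((Fin n → ℝ) → ℝ) → ℝ≥0∞) (N : ℝ≥0 → ℝ≥0) : Prop :=
  ∀ (K : ℝ≥0) (w : (Fin n → ℝ) → ℝ), IsWeight w → char w ≤ K →
    ∀ fg ∈ F, lpNorm p w fg.1 < ∞ → lpNorm p w fg.1 ≤ N K * lpNorm p w fg.2

end RHExtrapolation

end

/-! Fix `w` in the target class and put `σ = p / (p - p₀)`. Since `∫ f^p w = ∫ f^{p₀} h w` with `h =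
f^{p - p₀}` in `L^σ(w)`, it suffices to find `H ≥ h` of comparable `L^σ(w)` norm with `H w` in
`RH_{Ψ₀}`. The hypothesis then applies to `H w`, Hölder's inequality splits `∫ g^{p₀} H w`, and the
surplus power of the finite quantity `∫ f^p w` cancels (`lpNorm_le_of_majorant`).

The majorant comes from the Rubio de Francia algorithm for an Orlicz maximal operator with respect
to `w dx`, with gauge `A(x) = x Ψ₀(x^β) / x^β`. The gauge is designed so that `Ψ₀(x y) ≤ Ψ(y) + y
A(x)`, with `β = 1 / (1 - r)`; for `RH_∞` one takes `β = 1` and replaces `Ψ` by the gauge that is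
`0` on `[0, 1]` and `∞` beyond. With `y` a normalised value of `w`, the first term is controlled by
the condition on `w` and the second is an Orlicz average of `H` against `w dx`. So a pointwise bound
of the maximal function of `H` by a multiple of `H` puts `H w` in `RH_{Ψ₀}`
(`rhConst_mulWeight_le`).

The operator is bounded on `L^σ(w)` for two reasons: superlinearity of the gauge makes `w dx`
doubling (`exists_doubling`), which gives a weak type bound, and the substitution `v = u^β` turns
the `B_s` condition on `Ψ₀` into the `B_σ` growth condition on `A`, because `σ - 1 = β (s - 1)`.
Only the monotonicity of `A(x) / x` is used in place of convexity of `A`; it gives countable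
subadditivity up to a factor `2` (`half_mul_le_tsum`). -/

namespace RHExtrapolation

/-! ### Covering estimates for doubling measures. -/

section Maximal

variable {X : Type*} [MetricSpace X] [SecondCountableTopology X] [MeasurableSpace X] [BorelSpace X]

/-- Covering lemma behind the weak type bound, for balls of bounded radius. -/
theorem measure_iUnion_ball_le_of_radius_le (μ : Measure X) {D : ℝ≥0∞}
    (hD : ∀ (c : X) (ρ : ℝ), 0 < ρ →
      μ (Metric.closedBall c (5 * ρ)) ≤ D * μ (Metric.closedBall c ρ))
    (F : X → ℝ≥0∞) (s : Set (X × ℝ)) (R : ℝ) (hR : ∀ q ∈ s, q.2 ≤ R)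
    (hpos : ∀ q ∈ s, 0 < q.2)
    (hF : ∀ q ∈ s, μ (Metric.closedBall q.1 q.2) ≤ ∫⁻ y in Metric.closedBall q.1 q.2, F y ∂μ) :
    μ (⋃ q ∈ s, Metric.ball q.1 q.2) ≤ D * ∫⁻ y, F y ∂μ := by
  obtain ⟨u, hus, hdisj, hcov⟩ := Vitali.exists_disjoint_subfamily_covering_enlargement_closedBall
    s (fun q => q.1) (fun q => q.2) R hR 5 (by norm_num)
  have hcount : u.Countable := hdisj.countable_of_nonempty_interior fun q hq =>
    ⟨q.1, Metric.ball_subset_interior_closedBall (Metric.mem_ball_self (hpos q (hus hq)))⟩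
  calc μ (⋃ q ∈ s, Metric.ball q.1 q.2)
      ≤ μ (⋃ q ∈ u, Metric.closedBall q.1 (5 * q.2)) := by
        refine measure_mono (iUnion₂_subset fun q hq => ?_)
        obtain ⟨b, hb, hqb⟩ := hcov q hq
        exact (Metric.ball_subset_closedBall.trans hqb).trans
          (subset_biUnion_of_mem (u := fun q : X × ℝ => Metric.closedBall q.1 (5 * q.2)) hb)
    _ ≤ ∑' q : u, μ (Metric.closedBall q.1.1 (5 * q.1.2)) := measure_biUnion_le μ hcount _
    _ ≤ ∑' q : u, D * ∫⁻ y in Metric.closedBall q.1.1 q.1.2, F y ∂μ :=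
        ENNReal.tsum_le_tsum fun q => (hD _ _ (hpos _ (hus q.2))).trans
          (mul_le_mul_right (hF _ (hus q.2)) D)
    _ = D * ∫⁻ y in ⋃ q ∈ u, Metric.closedBall q.1 q.2, F y ∂μ := by
        rw [ENNReal.tsum_mul_left, lintegral_biUnion hcount
          (fun q _ => Metric.isClosed_closedBall.measurableSet) hdisj]
    _ ≤ D * ∫⁻ y, F y ∂μ := mul_le_mul_right (setLIntegral_le_lintegral _ _) D

/-- Covering lemma behind the weak type bound for maximal operators. -/
theorem measure_iUnion_ball_le (μ : Measure X) {D : ℝ≥0∞}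
    (hD : ∀ (c : X) (ρ : ℝ), 0 < ρ →
      μ (Metric.closedBall c (5 * ρ)) ≤ D * μ (Metric.closedBall c ρ))
    (F : X → ℝ≥0∞) (s : Set (X × ℝ)) (hpos : ∀ q ∈ s, 0 < q.2)
    (hF : ∀ q ∈ s, μ (Metric.closedBall q.1 q.2) ≤ ∫⁻ y in Metric.closedBall q.1 q.2, F y ∂μ) :
    μ (⋃ q ∈ s, Metric.ball q.1 q.2) ≤ D * ∫⁻ y, F y ∂μ := by
  -- The Vitali lemma needs bounded radii; cutting off at radius `k` exhausts the union with a bound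
  -- uniform in `k`.
  have hmono : Monotone fun k : ℕ =>
      ⋃ q ∈ {q ∈ s | q.2 ≤ k}, Metric.ball q.1 q.2 := fun i j hij =>
    biUnion_subset_biUnion_left fun q hq => ⟨hq.1, hq.2.trans (Nat.cast_le.2 hij)⟩
  have hunion : (⋃ q ∈ s, Metric.ball q.1 q.2) =
      ⋃ k : ℕ, ⋃ q ∈ {q ∈ s | q.2 ≤ k}, Metric.ball q.1 q.2 := by
    ext x
    simp only [mem_iUnion, exists_prop, mem_ofPred_eq]
    constructor
    · rintro ⟨q, hq, hx⟩
      obtain ⟨k, hk⟩ := exists_nat_ge q.2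
      exact ⟨k, q, ⟨hq, hk⟩, hx⟩
    · rintro ⟨k, q, ⟨hq, -⟩, hx⟩
      exact ⟨q, hq, hx⟩
  rw [hunion, hmono.measure_iUnion]
  exact iSup_le fun k => measure_iUnion_ball_le_of_radius_le μ hD F _ k (fun q hq => hq.2)
    (fun q hq => hpos q hq.1) fun q hq => hF q hq.1

end Maximal

/-! ### The Orlicz maximal function and its weak type bound. -/

section Maximal

variable {X : Type*} [MetricSpace X] [MeasurableSpace X]

/-- The Orlicz maximal function of `h` with respect to `μ` and the gauge `A`: the supremum of the
numbers `t` such that `⨍_Q A (h / t) dμ > 1` for some ball `Q` containing the point. -/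
noncomputable def orliczMaximal (μ : Measure X) (A : ℝ≥0∞ → ℝ≥0∞) (h : X → ℝ≥0∞) (x : X) :
    ℝ≥0∞ :=
  ⨆ (q : X × ℝ) (t : ℝ≥0∞) (_ : x ∈ Metric.ball q.1 q.2 ∧
    μ (Metric.closedBall q.1 q.2) < ∫⁻ y in Metric.closedBall q.1 q.2, A (h y / t) ∂μ), t

theorem lt_orliczMaximal_iff {μ : Measure X} {A : ℝ≥0∞ → ℝ≥0∞}
    {h : X → ℝ≥0∞} {x : X} {t : ℝ≥0∞} :
    t < orliczMaximal μ A h x ↔ ∃ (q : X × ℝ) (t' : ℝ≥0∞), t < t' ∧ x ∈ Metric.ball q.1 q.2 ∧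
      μ (Metric.closedBall q.1 q.2) < ∫⁻ y in Metric.closedBall q.1 q.2, A (h y / t') ∂μ := by
  simp only [orliczMaximal, lt_iSup_iff, exists_prop]
  tauto

theorem setLIntegral_le_of_orliczMaximal_lt {μ : Measure X} {A : ℝ≥0∞ → ℝ≥0∞}
    {h : X → ℝ≥0∞} {x : X} {t : ℝ≥0∞} (ht : orliczMaximal μ A h x < t) {c : X} {ρ : ℝ}
    (hx : x ∈ Metric.ball c ρ) :
    ∫⁻ y in Metric.closedBall c ρ, A (h y / t) ∂μ ≤ μ (Metric.closedBall c ρ) := by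
  by_contra! hlt
  exact ht.not_ge (le_iSup₂_of_le (c, ρ) t (le_iSup_of_le ⟨hx, hlt⟩ le_rfl))

/-- Membership is tested on open balls while averages run over closed ones, so superlevel sets are
open and measurability requires nothing of `h` or `A`. -/
theorem setOf_lt_orliczMaximal_eq (μ : Measure X) (A : ℝ≥0∞ → ℝ≥0∞) (h : X → ℝ≥0∞) (t : ℝ≥0∞) :
    {x | t < orliczMaximal μ A h x} =
      ⋃ q ∈ {q : X × ℝ | ∃ t' : ℝ≥0∞, t < t' ∧ 0 < q.2 ∧ μ (Metric.closedBall q.1 q.2) <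
        ∫⁻ y in Metric.closedBall q.1 q.2, A (h y / t') ∂μ}, Metric.ball q.1 q.2 := by
  ext x
  simp only [mem_ofPred_eq, lt_orliczMaximal_iff, mem_iUnion, exists_prop]
  constructor
  · rintro ⟨q, t', htt', hx, hq⟩
    exact ⟨q, ⟨t', htt', Metric.pos_of_mem_ball hx, hq⟩, hx⟩
  · rintro ⟨q, ⟨t', htt', -, hq⟩, hx⟩
    exact ⟨q, t', htt', hx, hq⟩

theorem measurable_orliczMaximal [BorelSpace X] (μ : Measure X) (A : ℝ≥0∞ → ℝ≥0∞)
    (h : X → ℝ≥0∞) : Measurable (orliczMaximal μ A h) := by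
  refine measurable_of_Ioi fun t => ?_
  change MeasurableSet {x | t < orliczMaximal μ A h x}
  rw [setOf_lt_orliczMaximal_eq]
  exact (isOpen_biUnion fun q _ => Metric.isOpen_ball).measurableSet

end Maximal

/-- The part of `A` where it is larger than `1 / 2`. -/
noncomputable def upperPart (A : ℝ≥0∞ → ℝ≥0∞) (x : ℝ≥0∞) : ℝ≥0∞ :=
  open Classical in if 2⁻¹ < A x then A x else 0

theorem upperPart_mono {A : ℝ≥0∞ → ℝ≥0∞} (hA : Monotone A) : Monotone (upperPart A) := by
  intro x y hxy
  unfold upperPart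
  split_ifs with h1 h2
  · exact hA hxy
  · exact absurd (h1.trans_le (hA hxy)) h2
  · exact zero_le
  · exact le_rfl

theorem le_half_add_upperPart (A : ℝ≥0∞ → ℝ≥0∞) (x : ℝ≥0∞) : A x ≤ 2⁻¹ + upperPart A x := by
  unfold upperPart
  split_ifs with h
  · exact le_add_self
  · simpa using h

section Maximal

variable {X : Type*} [MetricSpace X] [SecondCountableTopology X] [MeasurableSpace X] [BorelSpace X]

/-- Weak type estimate for the Orlicz maximal function. -/
theorem measure_lt_orliczMaximal_le {μ : Measure X} {D : ℝ≥0∞}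
    (hD : ∀ (c : X) (ρ : ℝ), 0 < ρ →
      μ (Metric.closedBall c (5 * ρ)) ≤ D * μ (Metric.closedBall c ρ))
    (hfin : ∀ (c : X) (ρ : ℝ), μ (Metric.closedBall c ρ) < ∞)
    {A : ℝ≥0∞ → ℝ≥0∞} (hA : Monotone A) (h : X → ℝ≥0∞) (t : ℝ≥0∞) :
    μ {x | t < orliczMaximal μ A h x} ≤ 2 * D * ∫⁻ y, upperPart A (h y / t) ∂μ := by
  rw [setOf_lt_orliczMaximal_eq]
  have key := measure_iUnion_ball_le μ hD (fun y => 2 * upperPart A (h y / t))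
    {q : X × ℝ | ∃ t' : ℝ≥0∞, t < t' ∧ 0 < q.2 ∧ μ (Metric.closedBall q.1 q.2) <
        ∫⁻ y in Metric.closedBall q.1 q.2, A (h y / t') ∂μ} (fun q hq => hq.choose_spec.2.1) ?_
  · refine key.trans (le_of_eq ?_)
    rw [lintegral_const_mul' _ _ ENNReal.ofNat_ne_top]
    ring
  · rintro q ⟨t', htt', -, hq⟩
    set Q := Metric.closedBall q.1 q.2 with hQ
    -- Values of the gauge below `1 / 2` account for at most half of `μ Q`; since `μ Q` is finite,
    -- this half can be subtracted and the upper part carries the rest.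
    have h1 : μ Q ≤ 2⁻¹ * μ Q + ∫⁻ y in Q, upperPart A (h y / t) ∂μ := by
      refine hq.le.trans ?_
      calc ∫⁻ y in Q, A (h y / t') ∂μ
          ≤ ∫⁻ y in Q, (2⁻¹ + upperPart A (h y / t)) ∂μ := by
            refine lintegral_mono fun y => (le_half_add_upperPart A _).trans ?_
            gcongr
            exact upperPart_mono hA (ENNReal.div_le_div_left htt'.le _)
        _ = 2⁻¹ * μ Q + ∫⁻ y in Q, upperPart A (h y / t) ∂μ := by
            rw [lintegral_add_left measurable_const, setLIntegral_const]
    have hQfin : μ Q ≠ ∞ := (hfin _ _).ne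
    have h2 : μ Q = 2⁻¹ * μ Q + 2⁻¹ * μ Q := by
      rw [← add_mul, ENNReal.inv_two_add_inv_two, one_mul]
    have h3 : 2⁻¹ * μ Q ≤ ∫⁻ y in Q, upperPart A (h y / t) ∂μ := by
      have h4 : 2⁻¹ * μ Q + 2⁻¹ * μ Q ≤ 2⁻¹ * μ Q + ∫⁻ y in Q, upperPart A (h y / t) ∂μ :=
        h2 ▸ h1
      exact (ENNReal.add_le_add_iff_left (ENNReal.mul_ne_top (by simp) hQfin)).1 h4
    rw [lintegral_const_mul' _ _ ENNReal.ofNat_ne_top]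
    calc μ Q = 2 * (2⁻¹ * μ Q) := by
          rw [← mul_assoc, ENNReal.mul_inv_cancel (by simp) (by simp), one_mul]
      _ ≤ _ := mul_le_mul_right h3 2

end Maximal

/-! ### The strong type bound on `L^σ`, by dyadic summation. -/

/-- Dyadic decomposition of a power. -/
theorem rpow_le_tsum_indicator {σ : ℝ} (hσ : 0 < σ) (y : ℝ≥0∞) :
    y ^ σ ≤ ∑' j : ℤ, ((2 : ℝ≥0∞) ^ (j + 1)) ^ σ * (Ioi ((2 : ℝ≥0∞) ^ j)).indicator 1 y := by
  rcases eq_or_ne y 0 with rfl | h0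
  · simp [hσ]
  rcases eq_or_ne y ∞ with rfl | htop
  · suffices h : (∑' j : ℤ, ((2 : ℝ≥0∞) ^ (j + 1)) ^ σ *
        (Ioi ((2 : ℝ≥0∞) ^ j)).indicator 1 ∞) = ∞ by rw [h]; exact le_top
    rw [eq_top_iff]
    calc ∞ = ∑' _ : ℕ, (1 : ℝ≥0∞) := (ENNReal.tsum_const_eq_top_of_ne_zero one_ne_zero).symm
      _ ≤ ∑' k : ℕ, ((2 : ℝ≥0∞) ^ ((k : ℤ) + 1)) ^ σ *
          (Ioi ((2 : ℝ≥0∞) ^ (k : ℤ))).indicator 1 ∞ := by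
        refine ENNReal.tsum_le_tsum fun k => ?_
        have h1 : (2 : ℝ≥0∞) ^ (k : ℤ) < ∞ := ENNReal.zpow_lt_top (by simp) (by simp) _
        rw [indicator_of_mem (mem_Ioi.2 h1), Pi.one_apply, mul_one]
        refine ENNReal.one_le_rpow ?_ hσ
        have : ((k : ℤ) + 1) = ((k + 1 : ℕ) : ℤ) := by push_cast; rfl
        rw [this, zpow_natCast]
        exact one_le_pow₀ (by norm_num)
      _ ≤ _ := ENNReal.tsum_comp_le_tsum_of_injective (f := fun k : ℕ => (k : ℤ))
          Nat.cast_injective (fun j : ℤ => ((2 : ℝ≥0∞) ^ (j + 1)) ^ σ *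
          (Ioi ((2 : ℝ≥0∞) ^ j)).indicator 1 ∞)
  · obtain ⟨m, hm1, hm2⟩ := ENNReal.exists_mem_Ioc_zpow h0 htop (y := 2) (by norm_num) (by simp)
    refine le_trans ?_ (ENNReal.le_tsum m)
    rw [indicator_of_mem (mem_Ioi.2 hm1), Pi.one_apply, mul_one]
    exact ENNReal.rpow_le_rpow hm2 hσ.le

/-- The dyadic form of the growth condition `∫ A(u) u^{-σ} du/u < ∞`. -/
noncomputable def dyadicGrowth (A : ℝ≥0∞ → ℝ≥0∞) (σ : ℝ) : ℝ≥0∞ :=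
  ∑' i : ℤ, ((2 : ℝ≥0∞) ^ (-i)) ^ σ * upperPart A (2 ^ i)

/-- Dyadic form of the change of variables in `∫ λ^σ A(t / λ) dλ / λ`: if `2^m < t ≤ 2^(m+1)`, the
reindexing `j = m + 1 - i` gives `t / 2^j ≤ 2^i` and `2^(j+1) ≤ 4 * 2^(-i) * t`. -/
theorem tsum_upperPart_le {A : ℝ≥0∞ → ℝ≥0∞} (hA : Monotone A) {σ : ℝ} (hσ : 0 < σ)
    (hA0 : A 0 = 0) (t : ℝ≥0∞) (ht : t ≠ ∞) :
    ∑' j : ℤ, ((2 : ℝ≥0∞) ^ (j + 1)) ^ σ * upperPart A (t / 2 ^ j) ≤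
      4 ^ σ * dyadicGrowth A σ * t ^ σ := by
  rcases eq_or_ne t 0 with rfl | h0
  · have : upperPart A 0 = 0 := by simp [upperPart, hA0]
    simp [this]
  obtain ⟨m, hm1, hm2⟩ := ENNReal.exists_mem_Ioc_zpow h0 ht (y := 2) (by norm_num) (by simp)
  have two0 : (2 : ℝ≥0∞) ≠ 0 := by simp
  have twot : (2 : ℝ≥0∞) ≠ ∞ := by simp
  rw [← (Equiv.subLeft (m + 1)).tsum_eq, dyadicGrowth, ← ENNReal.tsum_mul_left,
    ← ENNReal.tsum_mul_right]
  refine ENNReal.tsum_le_tsum fun i => ?_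
  have e1 : (2 : ℝ≥0∞) ^ (m + 1 - i + 1) ≤ 4 * 2 ^ (-i) * t := by
    have : (2 : ℝ≥0∞) ^ (m + 1 - i + 1) = 4 * 2 ^ (-i) * 2 ^ m := by
      have h4 : (4 : ℝ≥0∞) = 2 ^ (2 : ℤ) := by norm_num
      rw [h4, ← ENNReal.zpow_add two0 twot, ← ENNReal.zpow_add two0 twot]
      congr 1; ring
    rw [this]
    gcongr
  have e2 : t / 2 ^ (m + 1 - i) ≤ 2 ^ i := by
    have : (2 : ℝ≥0∞) ^ (m + 1) = 2 ^ i * 2 ^ (m + 1 - i) := by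
      rw [← ENNReal.zpow_add two0 twot]; congr 1; ring
    exact ENNReal.div_le_of_le_mul (this ▸ hm2)
  calc ((2 : ℝ≥0∞) ^ ((Equiv.subLeft (m + 1)) i + 1)) ^ σ *
        upperPart A (t / 2 ^ ((Equiv.subLeft (m + 1)) i))
      ≤ (4 * 2 ^ (-i) * t) ^ σ * upperPart A (2 ^ i) :=
        mul_le_mul' (ENNReal.rpow_le_rpow e1 hσ.le) (upperPart_mono hA e2)
    _ = _ := by
        rw [ENNReal.mul_rpow_of_nonneg _ _ hσ.le, ENNReal.mul_rpow_of_nonneg _ _ hσ.le]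
        ring

section Maximal

variable {X : Type*} [MetricSpace X] [SecondCountableTopology X] [MeasurableSpace X] [BorelSpace X]

/-- The Orlicz maximal function is bounded on `L^σ(μ)`. -/
theorem lintegral_orliczMaximal_rpow_le {μ : Measure X} {D : ℝ≥0∞}
    (hD : ∀ (c : X) (ρ : ℝ), 0 < ρ →
      μ (Metric.closedBall c (5 * ρ)) ≤ D * μ (Metric.closedBall c ρ))
    (hfin : ∀ (c : X) (ρ : ℝ), μ (Metric.closedBall c ρ) < ∞)
    {A : ℝ≥0∞ → ℝ≥0∞} (hA : Monotone A) (hA0 : A 0 = 0) {σ : ℝ} (hσ : 0 < σ)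
    {h : X → ℝ≥0∞} (hm : Measurable h) (hh : ∫⁻ x, h x ^ σ ∂μ ≠ ∞) :
    ∫⁻ x, orliczMaximal μ A h x ^ σ ∂μ ≤
      2 * D * (4 ^ σ * dyadicGrowth A σ) * ∫⁻ x, h x ^ σ ∂μ := by
  have hmT := measurable_orliczMaximal μ A h
  have hind : ∀ j : ℤ, Measurable fun x =>
      (Ioi ((2 : ℝ≥0∞) ^ j)).indicator (1 : ℝ≥0∞ → ℝ≥0∞) (orliczMaximal μ A h x) := fun j =>
    (measurable_one.indicator measurableSet_Ioi).comp hmT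
  have hup : ∀ j : ℤ, Measurable fun y => upperPart A (h y / 2 ^ j) := fun j =>
    (upperPart_mono hA).measurable.comp (hm.div_const _)
  calc ∫⁻ x, orliczMaximal μ A h x ^ σ ∂μ
      ≤ ∫⁻ x, ∑' j : ℤ, ((2 : ℝ≥0∞) ^ (j + 1)) ^ σ *
          (Ioi ((2 : ℝ≥0∞) ^ j)).indicator 1 (orliczMaximal μ A h x) ∂μ :=
        lintegral_mono fun x => rpow_le_tsum_indicator hσ _
    _ = ∑' j : ℤ, ((2 : ℝ≥0∞) ^ (j + 1)) ^ σ * μ {x | 2 ^ j < orliczMaximal μ A h x} := by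
        rw [lintegral_tsum fun j => ((hind j).const_mul _).aemeasurable]
        refine tsum_congr fun j => ?_
        rw [lintegral_const_mul _ (hind j)]
        congr 1
        exact lintegral_indicator_one (hmT measurableSet_Ioi)
    _ ≤ ∑' j : ℤ, ((2 : ℝ≥0∞) ^ (j + 1)) ^ σ *
          (2 * D * ∫⁻ y, upperPart A (h y / 2 ^ j) ∂μ) :=
        ENNReal.tsum_le_tsum fun j =>
          mul_le_mul_right (measure_lt_orliczMaximal_le hD hfin hA h _) _
    _ = 2 * D * ∫⁻ y, ∑' j : ℤ, ((2 : ℝ≥0∞) ^ (j + 1)) ^ σ * upperPart A (h y / 2 ^ j) ∂μ := by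
        rw [lintegral_tsum fun j => ((hup j).const_mul _).aemeasurable,
          ← ENNReal.tsum_mul_left]
        refine tsum_congr fun j => ?_
        rw [lintegral_const_mul _ (hup j)]
        ring
    _ ≤ 2 * D * ∫⁻ y, 4 ^ σ * dyadicGrowth A σ * h y ^ σ ∂μ := by
        refine mul_le_mul_right (lintegral_mono_ae ?_) _
        filter_upwards [ae_lt_top' (hm.pow_const σ).aemeasurable hh] with y hy
        refine tsum_upperPart_le hA hσ hA0 _ fun htop => ?_
        simp [htop, hσ] at hy
    _ = _ := by
        rw [lintegral_const_mul _ (hm.pow_const σ)]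
        ring

end Maximal

/-! ### Subadditivity and the Rubio de Francia algorithm. -/

/-- A function `x * a x` with `a` increasing is convex up to a factor `2`. -/
theorem half_mul_le_tsum {a : ℝ≥0∞ → ℝ≥0∞} (ha : Monotone a) (ρ x : ℕ → ℝ≥0∞)
    (hρ : ∑' k, ρ k ≤ 1) (hm : ∑' k, ρ k * x k ≠ ∞) :
    (∑' k, ρ k * x k) / 2 * a ((∑' k, ρ k * x k) / 2) ≤ ∑' k, ρ k * (x k * a (x k)) := by
  classical
  set m := ∑' k, ρ k * x k with hmdef
  -- Indices with `x k < m / 2` carry at most `m / 2` of the mean, because the weights sum to at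
  -- most `1`; on the others `a (x k) ≥ a (m / 2)`.
  have h1 : m ≤ m / 2 + ∑' k, if m / 2 ≤ x k then ρ k * x k else 0 := by
    calc m ≤ ∑' k, (ρ k * (m / 2) + if m / 2 ≤ x k then ρ k * x k else 0) := by
          refine ENNReal.tsum_le_tsum fun k => ?_
          split_ifs with h
          · exact le_add_self
          · simpa using mul_le_mul_right (not_le.1 h).le (ρ k)
      _ ≤ _ := by
          rw [ENNReal.tsum_add, ENNReal.tsum_mul_right]
          gcongr
          simpa using mul_le_mul_left hρ (m / 2)
  have h2 : m / 2 ≤ ∑' k, if m / 2 ≤ x k then ρ k * x k else 0 := by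
    nth_rewrite 1 [← ENNReal.add_halves m] at h1
    exact (ENNReal.add_le_add_iff_left (ENNReal.div_ne_top hm (by simp))).1 h1
  calc m / 2 * a (m / 2) ≤ (∑' k, if m / 2 ≤ x k then ρ k * x k else 0) * a (m / 2) :=
        mul_le_mul_left h2 _
    _ = ∑' k, (if m / 2 ≤ x k then ρ k * x k else 0) * a (m / 2) := ENNReal.tsum_mul_right.symm
    _ ≤ ∑' k, ρ k * (x k * a (x k)) := by
        refine ENNReal.tsum_le_tsum fun k => ?_
        split_ifs with h
        · rw [mul_assoc]
          gcongr
          exact ha h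
        · simp

section Maximal

variable {X : Type*} [MetricSpace X] [MeasurableSpace X]

/-- Countable subadditivity, up to a factor `2`, of the Orlicz maximal function. -/
theorem orliczMaximal_tsum_le {μ : Measure X} {a : ℝ≥0∞ → ℝ≥0∞} (ha : Monotone a)
    {g : ℕ → X → ℝ≥0∞} (hg : ∀ k, Measurable (g k)) (hfin : ∀ᵐ y ∂μ, ∑' k, g k y ≠ ∞) (x : X) :
    orliczMaximal μ (fun t => t * a t) (fun y => ∑' k, g k y) x ≤
      2 * ∑' k, orliczMaximal μ (fun t => t * a t) (g k) x := by
  by_contra! hlt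
  obtain ⟨q, t, ht, hx, hq⟩ := lt_orliczMaximal_iff.1 hlt
  set Q := Metric.closedBall q.1 q.2 with hQ
  set T := fun k => orliczMaximal μ (fun t => t * a t) (g k) x with hT
  -- At `t = ∞` the gauge is evaluated at `0`, where it vanishes, so the strict inequality `hq`
  -- fails.
  have httop : t ≠ ∞ := by
    rintro rfl
    simp at hq
  have hT2 : ∑' k, T k < t / 2 := by
    rw [ENNReal.lt_div_iff_mul_lt (by simp) (by simp), mul_comm]
    exact ht
  have ht2top : t / 2 ≠ ∞ := ENNReal.div_ne_top httop (by simp)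
  have ht20 : t / 2 ≠ 0 := (zero_le.trans_lt hT2).ne'
  -- The slack in `∑ T k < t / 2` is spread over all `k`, giving levels `l k > T k` with sum at most
  -- `t / 2`. Then `(∑ g k) / (t / 2)` is the combination of the `g k / l k` with weights `l k / (t
  -- / 2)`, and each `g k` has Orlicz average at most `1` at level `l k`.
  obtain ⟨ε, hε0, hε⟩ := ENNReal.exists_pos_sum_of_countable (tsub_pos_of_lt hT2).ne' ℕ
  set l := fun k => T k + ε k with hl
  have hlsum : ∑' k, l k ≤ t / 2 := by
    rw [ENNReal.tsum_add]
    calc _ ≤ ∑' k, T k + (t / 2 - ∑' k, T k) := by gcongr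
      _ = t / 2 := add_tsub_cancel_of_le hT2.le
  have hTk : ∀ k, T k ≠ ∞ := fun k =>
    ((ENNReal.le_tsum k).trans_lt (hT2.trans ht2top.lt_top)).ne
  have hlT : ∀ k, T k < l k := fun k =>
    ENNReal.lt_add_right (hTk k) (by simpa using (hε0 k).ne')
  have hltop : ∀ k, l k ≠ ∞ := fun k => ENNReal.add_ne_top.2 ⟨hTk k, ENNReal.coe_ne_top⟩
  have hl0 : ∀ k, l k ≠ 0 := fun k => (zero_le.trans_lt (hlT k)).ne'
  have hρ : ∑' k, l k / (t / 2) ≤ 1 := by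
    simp only [div_eq_mul_inv (l _), ENNReal.tsum_mul_right]
    rw [← div_eq_mul_inv]
    exact ENNReal.div_le_of_le_mul (by simpa using hlsum)
  refine hq.not_ge ?_
  calc ∫⁻ y in Q, (∑' k, g k y) / t * a ((∑' k, g k y) / t) ∂μ
      ≤ ∫⁻ y in Q, ∑' k, l k / (t / 2) * (g k y / l k * a (g k y / l k)) ∂μ := by
        refine lintegral_mono_ae (ae_restrict_of_ae ?_)
        filter_upwards [hfin] with y hy
        have hsum : ∑' k, l k / (t / 2) * (g k y / l k) = (∑' k, g k y) / (t / 2) := by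
          rw [div_eq_mul_inv _ (t / 2), ← ENNReal.tsum_mul_right]
          refine tsum_congr fun k => ?_
          calc l k / (t / 2) * (g k y / l k) = (l k * (l k)⁻¹) * (g k y * (t / 2)⁻¹) := by
                simp only [div_eq_mul_inv (l k), div_eq_mul_inv (g k y)]
                ring
            _ = g k y * (t / 2)⁻¹ := by rw [ENNReal.mul_inv_cancel (hl0 k) (hltop k), one_mul]
        have hhalf : (∑' k, g k y) / t = (∑' k, g k y) / (t / 2) / 2 := by
          rw [div_eq_mul_inv, div_eq_mul_inv, div_eq_mul_inv, div_eq_mul_inv,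
            ENNReal.mul_inv (Or.inr (by simp)) (Or.inl httop), inv_inv, mul_assoc, mul_assoc,
            ENNReal.mul_inv_cancel (by simp) (by simp), mul_one]
        rw [hhalf, ← hsum]
        refine half_mul_le_tsum ha _ _ hρ ?_
        rw [hsum]
        exact ENNReal.div_ne_top hy ht20
    _ = ∑' k, l k / (t / 2) * ∫⁻ y in Q, g k y / l k * a (g k y / l k) ∂μ := by
        have hmeas : ∀ k, Measurable fun y => g k y / l k * a (g k y / l k) := fun k =>
          ((hg k).div_const _).mul (ha.measurable.comp ((hg k).div_const _))
        rw [lintegral_tsum fun k => ((hmeas k).const_mul _).aemeasurable]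
        exact tsum_congr fun k => lintegral_const_mul _ (hmeas k)
    _ ≤ ∑' k, l k / (t / 2) * μ Q := ENNReal.tsum_le_tsum fun k =>
        mul_le_mul_right (setLIntegral_le_of_orliczMaximal_lt (A := fun t => t * a t) (hlT k) hx) _
    _ ≤ μ Q := by
        rw [ENNReal.tsum_mul_right]
        simpa using mul_le_mul_left hρ (μ Q)

/-- The Rubio de Francia iterates `g₀ = h`, `g_{k+1} = (4 B)⁻¹ T g_k`. -/
noncomputable def rubioIter (μ : Measure X) (A : ℝ≥0∞ → ℝ≥0∞) (B : ℝ≥0∞) (h : X → ℝ≥0∞) :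
    ℕ → X → ℝ≥0∞
  | 0 => h
  | k + 1 => fun x => (4 * B)⁻¹ * orliczMaximal μ A (rubioIter μ A B h k) x

variable [BorelSpace X]

theorem measurable_rubioIter (μ : Measure X) (A : ℝ≥0∞ → ℝ≥0∞) (B : ℝ≥0∞) {h : X → ℝ≥0∞}
    (hm : Measurable h) (k : ℕ) : Measurable (rubioIter μ A B h k) := by
  cases k with
  | zero => exact hm
  | succ k => exact (measurable_orliczMaximal μ A _).const_mul _

/-- Each step costs a factor `B` in norm and gains `(4 B)⁻¹`; the decay `4^(-k)` leaves room for the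
weights `2^k` used in summing the series. -/
theorem lintegral_rubioIter_rpow_le {μ : Measure X} {A : ℝ≥0∞ → ℝ≥0∞} {B : ℝ≥0∞} (hB0 : B ≠ 0)
    (hBtop : B ≠ ∞) {σ : ℝ} (hσ : 0 < σ)
    (hB : ∀ h : X → ℝ≥0∞, Measurable h → ∫⁻ x, h x ^ σ ∂μ ≠ ∞ →
      ∫⁻ x, orliczMaximal μ A h x ^ σ ∂μ ≤ B ^ σ * ∫⁻ x, h x ^ σ ∂μ)
    {h : X → ℝ≥0∞} (hm : Measurable h) (hh : ∫⁻ x, h x ^ σ ∂μ ≠ ∞) (k : ℕ) :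
    ∫⁻ x, rubioIter μ A B h k x ^ σ ∂μ ≤ ((4 : ℝ≥0∞)⁻¹ ^ k) ^ σ * ∫⁻ x, h x ^ σ ∂μ := by
  induction k with
  | zero => simp [rubioIter]
  | succ k ih =>
    have hne : ∫⁻ x, rubioIter μ A B h k x ^ σ ∂μ ≠ ∞ := by
      refine ne_top_of_le_ne_top (ENNReal.mul_ne_top ?_ hh) ih
      exact ENNReal.rpow_ne_top_of_nonneg hσ.le (ENNReal.pow_ne_top (by simp))
    calc ∫⁻ x, ((4 * B)⁻¹ * orliczMaximal μ A (rubioIter μ A B h k) x) ^ σ ∂μ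
        = ((4 * B)⁻¹) ^ σ * ∫⁻ x, orliczMaximal μ A (rubioIter μ A B h k) x ^ σ ∂μ := by
          simp_rw [ENNReal.mul_rpow_of_nonneg _ _ hσ.le]
          exact lintegral_const_mul _ ((measurable_orliczMaximal μ A _).pow_const σ)
      _ ≤ ((4 * B)⁻¹) ^ σ * (B ^ σ * (((4 : ℝ≥0∞)⁻¹ ^ k) ^ σ * ∫⁻ x, h x ^ σ ∂μ)) := by
          gcongr
          exact (hB _ (measurable_rubioIter μ A B hm k) hne).trans (mul_le_mul_right ih _)
      _ = _ := by
          rw [← mul_assoc, ← mul_assoc, ← ENNReal.mul_rpow_of_nonneg _ _ hσ.le,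
            ← ENNReal.mul_rpow_of_nonneg _ _ hσ.le]
          congr 2
          rw [ENNReal.mul_inv (by simp) (by simp), mul_assoc 4⁻¹, ENNReal.inv_mul_cancel hB0 hBtop,
            mul_one, pow_succ, mul_comm]

/-- The constant in the norm estimate for the Rubio de Francia majorant. -/
noncomputable def rubioConst (σ : ℝ) : ℝ≥0∞ := 2 ^ σ * (1 - 2⁻¹ ^ σ)⁻¹

theorem rubioConst_ne_top {σ : ℝ} (hσ : 0 < σ) : rubioConst σ ≠ ∞ := by
  refine ENNReal.mul_ne_top (ENNReal.rpow_ne_top_of_nonneg hσ.le (by simp)) ?_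
  rw [ENNReal.inv_ne_top]
  exact (tsub_pos_of_lt (ENNReal.rpow_lt_one (by simp) hσ)).ne'

/-- The Rubio de Francia algorithm: a majorant `H` of `h`, of comparable norm, on which the
maximal operator acts boundedly in the pointwise sense. -/
theorem exists_rubio_majorant {μ : Measure X} {a : ℝ≥0∞ → ℝ≥0∞} (ha : Monotone a) {B : ℝ≥0∞}
    (hB0 : B ≠ 0) (hBtop : B ≠ ∞) {σ : ℝ} (hσ : 0 < σ)
    (hB : ∀ h : X → ℝ≥0∞, Measurable h → ∫⁻ x, h x ^ σ ∂μ ≠ ∞ →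
      ∫⁻ x, orliczMaximal μ (fun t => t * a t) h x ^ σ ∂μ ≤ B ^ σ * ∫⁻ x, h x ^ σ ∂μ)
    {h : X → ℝ≥0∞} (hm : Measurable h) (hh : ∫⁻ x, h x ^ σ ∂μ ≠ ∞) :
    ∃ H : X → ℝ≥0∞, Measurable H ∧ (∀ x, h x ≤ H x) ∧
      ∫⁻ x, H x ^ σ ∂μ ≤ rubioConst σ * ∫⁻ x, h x ^ σ ∂μ ∧
      ∀ x, orliczMaximal μ (fun t => t * a t) H x ≤ 8 * B * H x := by
  set A : ℝ≥0∞ → ℝ≥0∞ := fun t => t * a t with hA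
  set g := rubioIter μ A B h with hg
  have hgm : ∀ k, Measurable (g k) := measurable_rubioIter μ A B hm
  set H : X → ℝ≥0∞ := fun x => ∑' k, g k x with hH
  have hHm : Measurable H := Measurable.tsum hgm
  -- The bound `H ≤ 2 sup (2^k g k)` turns the power of a sum into a sum of powers without
  -- Minkowski's inequality.
  have hpt : ∀ x, H x ^ σ ≤ 2 ^ σ * ∑' k, (2 ^ k * g k x) ^ σ := fun x => by
    have h1 : H x ≤ 2 * ⨆ k, 2 ^ k * g k x := by
      nth_rewrite 1 [← ENNReal.tsum_geometric_two]
      rw [← ENNReal.tsum_mul_right]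
      refine ENNReal.tsum_le_tsum fun k => ?_
      calc g k x = 2⁻¹ ^ k * (2 ^ k * g k x) := by
            rw [← mul_assoc, ← mul_pow, ENNReal.inv_mul_cancel (by simp) (by simp), one_pow,
              one_mul]
        _ ≤ _ := mul_le_mul_right (le_iSup (fun k => 2 ^ k * g k x) k) _
    calc H x ^ σ ≤ (2 * ⨆ k, 2 ^ k * g k x) ^ σ := ENNReal.rpow_le_rpow h1 hσ.le
      _ = 2 ^ σ * ⨆ k, (2 ^ k * g k x) ^ σ := by
          rw [ENNReal.mul_rpow_of_nonneg _ _ hσ.le]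
          congr 1
          exact (ENNReal.orderIsoRpow σ hσ).map_iSup _
      _ ≤ _ := by
          gcongr
          exact iSup_le fun k => ENNReal.le_tsum k
  have hHσ : ∫⁻ x, H x ^ σ ∂μ ≤ rubioConst σ * ∫⁻ x, h x ^ σ ∂μ := by
    calc ∫⁻ x, H x ^ σ ∂μ ≤ ∫⁻ x, 2 ^ σ * ∑' k, (2 ^ k * g k x) ^ σ ∂μ := lintegral_mono hpt
      _ = 2 ^ σ * ∑' k : ℕ, ((2 : ℝ≥0∞) ^ k) ^ σ * ∫⁻ x, g k x ^ σ ∂μ := by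
          have hmk : ∀ k : ℕ, Measurable fun x => (2 ^ k * g k x) ^ σ := fun k =>
            ((hgm k).const_mul _).pow_const σ
          rw [lintegral_const_mul _ (Measurable.tsum hmk),
            lintegral_tsum fun k => (hmk k).aemeasurable]
          congr 2
          ext k
          simp_rw [ENNReal.mul_rpow_of_nonneg _ _ hσ.le]
          exact lintegral_const_mul _ ((hgm k).pow_const σ)
      _ ≤ 2 ^ σ * ∑' k : ℕ, ((2⁻¹ : ℝ≥0∞) ^ σ) ^ k * ∫⁻ x, h x ^ σ ∂μ := by
          refine mul_le_mul_right (ENNReal.tsum_le_tsum fun k => ?_) _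
          refine (mul_le_mul_right
            (lintegral_rubioIter_rpow_le hB0 hBtop hσ hB hm hh k) _).trans (le_of_eq ?_)
          rw [← mul_assoc, ← ENNReal.mul_rpow_of_nonneg _ _ hσ.le, ← mul_pow]
          congr 1
          have h4 : (2 : ℝ≥0∞) * 4⁻¹ = 2⁻¹ := by
            rw [show (4 : ℝ≥0∞) = 2 * 2 by norm_num, ENNReal.mul_inv (by simp) (by simp),
              ← mul_assoc, ENNReal.mul_inv_cancel (by simp) (by simp), one_mul]
          rw [h4, ← ENNReal.rpow_natCast, ← ENNReal.rpow_natCast, ← ENNReal.rpow_mul,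
            ← ENNReal.rpow_mul, mul_comm]
      _ = _ := by
          rw [ENNReal.tsum_mul_right, ENNReal.tsum_geometric, rubioConst, mul_assoc]
  refine ⟨H, hHm, fun x => ENNReal.le_tsum (f := fun k => g k x) 0, hHσ, fun x => ?_⟩
  have hHfin : ∀ᵐ y ∂μ, ∑' k, g k y ≠ ∞ := by
    have hne : ∫⁻ x, H x ^ σ ∂μ ≠ ∞ :=
      ne_top_of_le_ne_top (ENNReal.mul_ne_top (rubioConst_ne_top hσ) hh) hHσ
    filter_upwards [ae_lt_top' (hHm.pow_const σ).aemeasurable hne] with y hy htop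
    simp [hH, htop, hσ] at hy
  calc orliczMaximal μ A H x ≤ 2 * ∑' k, orliczMaximal μ A (g k) x :=
        orliczMaximal_tsum_le ha hgm hHfin x
    -- The maximal function of `g k` is `4 B` times the next iterate, so it merely shifts the series
    -- for `H`.
    _ = 2 * ∑' k, 4 * B * g (k + 1) x := by
        congr 2
        ext k
        change _ = 4 * B * ((4 * B)⁻¹ * orliczMaximal μ A (g k) x)
        rw [← mul_assoc, ENNReal.mul_inv_cancel (mul_ne_zero (by simp) hB0)
          (ENNReal.mul_ne_top (by simp) hBtop), one_mul]
    _ ≤ 2 * (4 * B * H x) := by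
        rw [ENNReal.tsum_mul_left]
        gcongr
        exact ENNReal.tsum_comp_le_tsum_of_injective (add_left_injective 1) fun k => g k x
    _ = 8 * B * H x := by ring

end Maximal

/-! ### Weights, gauge bounds and doubling. -/

section Weights

variable {n : ℕ}

theorem cube_eq_closedBall (a : Fin n → ℝ) {l : ℝ} (hl : 0 < l) :
    cube a l = Metric.closedBall (fun i => a i + l / 2) (l / 2) := by
  ext x
  rw [Metric.mem_closedBall, dist_pi_le_iff (by positivity)]
  refine forall_congr' fun i => ?_
  rw [Real.dist_eq, abs_le]
  constructor <;> rintro ⟨h1, h2⟩ <;> constructor <;> linarith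

/-- The measure `w dx`. -/
noncomputable def wMeasure (w : (Fin n → ℝ) → ℝ) : Measure (Fin n → ℝ) :=
  volume.withDensity fun x => ENNReal.ofReal (w x)

theorem IsWeight.aemeasurable {w : (Fin n → ℝ) → ℝ} (hw : IsWeight w) : AEMeasurable w volume :=
  hw.locInt.aestronglyMeasurable.aemeasurable

theorem wMeasure_apply {w : (Fin n → ℝ) → ℝ} (s : Set (Fin n → ℝ)) :
    wMeasure w s = ∫⁻ x in s, ENNReal.ofReal (w x) :=
  withDensity_apply' _ s

theorem wMeasure_closedBall_lt_top {w : (Fin n → ℝ) → ℝ} (hw : IsWeight w) (c : Fin n → ℝ)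
    (ρ : ℝ) : wMeasure w (Metric.closedBall c ρ) < ∞ := by
  rw [wMeasure_apply]
  exact (hw.locInt.integrableOn_isCompact (isCompact_closedBall c ρ)).lintegral_lt_top

theorem volume_closedBall_ne_zero (c : Fin n → ℝ) {ρ : ℝ} (hρ : 0 < ρ) :
    volume (Metric.closedBall c ρ) ≠ 0 := (Metric.measure_closedBall_pos volume c hρ).ne'

theorem volume_closedBall_ne_top (c : Fin n → ℝ) (ρ : ℝ) :
    volume (Metric.closedBall c ρ) ≠ ∞ := measure_closedBall_lt_top.ne

/-- Reconciles the closed cubes of the averages with the open balls on which the maximal function is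
tested. -/
theorem wMeasure_ball (w : (Fin n → ℝ) → ℝ) (c : Fin n → ℝ) {ρ : ℝ} (hρ : 0 < ρ) :
    wMeasure w (Metric.ball c ρ) = wMeasure w (Metric.closedBall c ρ) := by
  refine le_antisymm (measure_mono Metric.ball_subset_closedBall) ?_
  rw [← Metric.ball_union_sphere]
  refine (measure_union_le _ _).trans ?_
  have h0 : wMeasure w (Metric.sphere c ρ) = 0 :=
    withDensity_absolutelyContinuous volume (fun x => ENNReal.ofReal (w x))
      (Measure.addHaar_sphere_of_ne_zero volume c hρ.ne')
  rw [h0, add_zero]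

theorem exists_average {w : (Fin n → ℝ) → ℝ} (hw : IsWeight w) (c : Fin n → ℝ) {ρ : ℝ}
    (hρ : 0 < ρ) (h0 : wMeasure w (Metric.closedBall c ρ) ≠ 0) :
    ∃ m : ℝ, 0 < m ∧ wMeasure w (Metric.closedBall c ρ) =
      ENNReal.ofReal m * volume (Metric.closedBall c ρ) := by
  have hne : wMeasure w (Metric.closedBall c ρ) / volume (Metric.closedBall c ρ) ≠ ∞ :=
    ENNReal.div_ne_top (wMeasure_closedBall_lt_top hw c ρ).ne (volume_closedBall_ne_zero c hρ)
  refine ⟨(wMeasure w (Metric.closedBall c ρ) / volume (Metric.closedBall c ρ)).toReal,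
    ENNReal.toReal_pos (ENNReal.div_ne_zero.2 ⟨h0, volume_closedBall_ne_top c ρ⟩) hne, ?_⟩
  rw [ENNReal.ofReal_toReal hne,
    ENNReal.div_mul_cancel (volume_closedBall_ne_zero c hρ) (volume_closedBall_ne_top c ρ)]

/-- A common form of the conditions `RH_Φ` and `RH_∞`: on every cube `Q` of average `w_Q > 0` one
has `⨍_Q G (w / (K w_Q)) ≤ 1`. -/
def GaugeBound (G : ℝ → ℝ≥0∞) (K : ℝ) (w : (Fin n → ℝ) → ℝ) : Prop :=
  ∀ (c : Fin n → ℝ) (ρ m : ℝ), 0 < ρ → 0 < m →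
    wMeasure w (Metric.closedBall c ρ) = ENNReal.ofReal m * volume (Metric.closedBall c ρ) →
    ∫⁻ x in Metric.closedBall c ρ, G (w x / (K * m)) ≤ volume (Metric.closedBall c ρ)

/-- A gauge of superlinear growth gives a quantitative absolute continuity of `w dx`. -/
theorem exists_forall_wMeasure_le_half {G : ℝ → ℝ≥0∞} {K : ℝ} (hK : 0 < K)
    (hG : ∀ M : ℝ, ∃ L : ℝ, ∀ y, L ≤ y → ENNReal.ofReal (M * y) ≤ G y) :
    ∃ η : ℝ, 0 < η ∧ ∀ w : (Fin n → ℝ) → ℝ, IsWeight w → GaugeBound G K w →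
      ∀ (c : Fin n → ℝ) (ρ : ℝ), 0 < ρ → ∀ E ⊆ Metric.closedBall c ρ,
        volume E ≤ ENNReal.ofReal η * volume (Metric.closedBall c ρ) →
          wMeasure w E ≤ 2⁻¹ * wMeasure w (Metric.closedBall c ρ) := by
  -- Slope `4 K` and the choice of `η` below make each of the two resulting terms equal to a quarter
  -- of `m * volume Q`.
  obtain ⟨L, hL⟩ := hG (4 * K)
  refine ⟨1 / (4 * K * max L 1), by positivity, fun w hw hGB c ρ hρ E hE hEη => ?_⟩
  set Q := Metric.closedBall c ρ
  by_cases h0 : wMeasure w Q = 0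
  · rw [measure_mono_null hE h0]
    exact zero_le
  obtain ⟨m, hm, hmQ⟩ := exists_average hw c hρ h0
  have hpt : ∀ y : ℝ, ENNReal.ofReal y ≤
      ENNReal.ofReal (max L 1) + ENNReal.ofReal (1 / (4 * K)) * G y := fun y => by
    rcases le_total y (max L 1) with h | h
    · exact (ENNReal.ofReal_le_ofReal h).trans le_self_add
    · refine le_trans ?_ le_add_self
      calc ENNReal.ofReal y = ENNReal.ofReal (1 / (4 * K)) * ENNReal.ofReal (4 * K * y) := by
            rw [← ENNReal.ofReal_mul (by positivity)]
            congr 1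
            field_simp
        _ ≤ _ := mul_le_mul_right (hL y ((le_max_left _ _).trans h)) _
  calc wMeasure w E = ∫⁻ x in E, ENNReal.ofReal (K * m) * ENNReal.ofReal (w x / (K * m)) := by
        rw [wMeasure_apply]
        congr 1
        ext x
        rw [← ENNReal.ofReal_mul (by positivity), mul_div_cancel₀ _ (by positivity)]
    _ ≤ ∫⁻ x in E, ENNReal.ofReal (K * m) * (ENNReal.ofReal (max L 1) +
          ENNReal.ofReal (1 / (4 * K)) * G (w x / (K * m))) :=
        lintegral_mono fun x => mul_le_mul_right (hpt _) _
    _ = ENNReal.ofReal (K * m) * (ENNReal.ofReal (max L 1) * volume E +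
          ENNReal.ofReal (1 / (4 * K)) * ∫⁻ x in E, G (w x / (K * m))) := by
        rw [lintegral_const_mul' _ _ ENNReal.ofReal_ne_top, lintegral_add_left measurable_const,
          setLIntegral_const, lintegral_const_mul' _ _ ENNReal.ofReal_ne_top]
    _ ≤ ENNReal.ofReal (K * m) * (ENNReal.ofReal (max L 1) *
          (ENNReal.ofReal (1 / (4 * K * max L 1)) * volume Q) +
          ENNReal.ofReal (1 / (4 * K)) * volume Q) := by
        gcongr
        exact (lintegral_mono_set hE).trans (hGB c ρ m hρ hm hmQ)
    _ = ENNReal.ofReal (2⁻¹ * m) * volume Q := by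
        rw [← mul_assoc (ENNReal.ofReal (max L 1)), ← ENNReal.ofReal_mul (by positivity),
          ← add_mul, ← mul_assoc, ← ENNReal.ofReal_add (by positivity) (by positivity),
          ← ENNReal.ofReal_mul (by positivity)]
        congr 2
        have : 0 < max L 1 := by positivity
        field_simp
        norm_num
    _ = 2⁻¹ * wMeasure w Q := by
        rw [hmQ, ENNReal.ofReal_mul (by positivity), ENNReal.ofReal_inv_of_pos (by norm_num),
          mul_assoc]
        simp [Q]

/-- The doubling property of `w dx`, with a constant depending only on the gauge condition. -/
theorem exists_doubling {G : ℝ → ℝ≥0∞} {K : ℝ} (hK : 0 < K)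
    (hG : ∀ M : ℝ, ∃ L : ℝ, ∀ y, L ≤ y → ENNReal.ofReal (M * y) ≤ G y) :
    ∃ D : ℝ≥0∞, D ≠ ∞ ∧ ∀ w : (Fin n → ℝ) → ℝ, IsWeight w → GaugeBound G K w →
      ∀ (c : Fin n → ℝ) (ρ : ℝ), 0 < ρ →
        wMeasure w (Metric.closedBall c (5 * ρ)) ≤ D * wMeasure w (Metric.closedBall c ρ) := by
  obtain ⟨η, hη, hac⟩ := exists_forall_wMeasure_le_half (n := n) hK hG
  -- For `θ` close to `1` the shell `θQ \ Q` has proportion `1 - θ^(-n) ≤ η` of `θQ`, so it carries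
  -- at most half of the weight of `θQ`. Iterating `w(θQ) ≤ 2 w(Q)` until `θ^k > 5` gives doubling.
  obtain ⟨θ, hθ, hθη⟩ : ∃ θ : ℝ, 1 < θ ∧ θ ^ n * (1 - η) < 1 := by
    have hcont : Tendsto (fun θ : ℝ => θ ^ n * (1 - η)) (𝓝[>] 1) (𝓝 (1 ^ n * (1 - η))) :=
      (Continuous.tendsto (by fun_prop) 1).mono_left nhdsWithin_le_nhds
    have hlt : (1 : ℝ) ^ n * (1 - η) < 1 := by simpa using hη
    exact ((eventually_mem_nhdsWithin (a := (1 : ℝ)) (s := Ioi 1)).and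
      (hcont.eventually_lt_const hlt)).exists
  obtain ⟨k, hk⟩ := pow_unbounded_of_one_lt 5 hθ
  refine ⟨2 ^ k, by simp, fun w hw hGB c ρ hρ => ?_⟩
  have hθ0 : 0 < θ := by linarith
  have step : ∀ r : ℝ, 0 < r →
      wMeasure w (Metric.closedBall c (θ * r)) ≤ 2 * wMeasure w (Metric.closedBall c r) := by
    intro r hr
    set Q := Metric.closedBall c r
    set Q' := Metric.closedBall c (θ * r)
    have hsub : Q ⊆ Q' := Metric.closedBall_subset_closedBall (by nlinarith)
    have hE : volume (Q' \ Q) ≤ ENNReal.ofReal η * volume Q' := by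
      rw [measure_sdiff hsub Metric.isClosed_closedBall.measurableSet.nullMeasurableSet
        (volume_closedBall_ne_top c r), Real.volume_pi_closedBall c hr.le,
        Real.volume_pi_closedBall c (by positivity), ← ENNReal.ofReal_sub _ (by positivity),
        ← ENNReal.ofReal_mul hη.le, Fintype.card_fin]
      refine ENNReal.ofReal_le_ofReal ?_
      have h1 : (2 * (θ * r)) ^ n = θ ^ n * (2 * r) ^ n := by rw [← mul_pow]; ring
      have h2 : 0 < (2 * r) ^ n := by positivity
      rw [h1]
      nlinarith
    have h1 := hac w hw hGB c (θ * r) (by positivity) (Q' \ Q) sdiff_subset hE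
    have hfin : wMeasure w Q' ≠ ∞ := (wMeasure_closedBall_lt_top hw _ _).ne
    have h2 : 2⁻¹ * wMeasure w Q' + 2⁻¹ * wMeasure w Q' ≤
        wMeasure w Q + 2⁻¹ * wMeasure w Q' := by
      rw [← add_mul, ENNReal.inv_two_add_inv_two, one_mul]
      calc wMeasure w Q' = wMeasure w (Q ∪ Q' \ Q) := by rw [union_sdiff_cancel hsub]
        _ ≤ wMeasure w Q + wMeasure w (Q' \ Q) := measure_union_le _ _
        _ ≤ _ := by gcongr
    have h3 := (ENNReal.add_le_add_iff_right (ENNReal.mul_ne_top (by simp) hfin)).1 h2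
    calc wMeasure w Q' = 2 * (2⁻¹ * wMeasure w Q') := by
          rw [← mul_assoc, ENNReal.mul_inv_cancel (by simp) (by simp), one_mul]
      _ ≤ _ := mul_le_mul_right h3 2
  have iter : ∀ j : ℕ, wMeasure w (Metric.closedBall c (θ ^ j * ρ)) ≤
      2 ^ j * wMeasure w (Metric.closedBall c ρ) := by
    intro j
    induction j with
    | zero => simp
    | succ j ih =>
      calc wMeasure w (Metric.closedBall c (θ ^ (j + 1) * ρ))
          = wMeasure w (Metric.closedBall c (θ * (θ ^ j * ρ))) := by
            rw [pow_succ, mul_comm (θ ^ j), mul_assoc]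
        _ ≤ 2 * (2 ^ j * wMeasure w (Metric.closedBall c ρ)) :=
            (step _ (by positivity)).trans (mul_le_mul_right ih 2)
        _ = _ := by rw [pow_succ, mul_comm (2 ^ j) 2, mul_assoc]
  exact (measure_mono (Metric.closedBall_subset_closedBall
    (mul_le_mul_of_nonneg_right hk.le hρ.le))).trans (iter k)

end Weights

/-! ### The product weights `H w`. -/

section Weights

variable {n : ℕ}

theorem IsYoung.le_mul {Φ : ℝ → ℝ} (hΦ : IsYoung Φ) {s θ : ℝ} (hs : 0 ≤ s) (hθ : 0 ≤ θ)
    (hθ1 : θ ≤ 1) : Φ (θ * s) ≤ θ * Φ s := by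
  have h := hΦ.convex.2 (mem_Ici.2 hs) (mem_Ici.2 le_rfl) hθ (sub_nonneg.2 hθ1)
    (add_sub_cancel θ 1)
  simpa [hΦ.map_zero] using h

theorem lintegral_wMeasure {w : (Fin n → ℝ) → ℝ} (hw : IsWeight w) {H : (Fin n → ℝ) → ℝ≥0∞}
    (hH : AEMeasurable H volume) {s : Set (Fin n → ℝ)} (hs : MeasurableSet s) :
    ∫⁻ x in s, H x ∂(wMeasure w) = ∫⁻ x in s, ENNReal.ofReal (w x) * H x :=
  setLIntegral_withDensity_eq_lintegral_mul₀ hw.aemeasurable.ennreal_ofReal hH hs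

theorem IsWeight.ae_ne_top {w : (Fin n → ℝ) → ℝ} (hw : IsWeight w) {H : (Fin n → ℝ) → ℝ≥0∞}
    (hH : ∀ᵐ x ∂(wMeasure w), H x ≠ ∞) : ∀ᵐ x, ENNReal.ofReal (w x) ≠ 0 → H x ≠ ∞ :=
  (ae_withDensity_iff' hw.aemeasurable.ennreal_ofReal).1 hH

/-- The weight `H w` as a real function. -/
noncomputable def mulWeight (w : (Fin n → ℝ) → ℝ) (H : (Fin n → ℝ) → ℝ≥0∞) (x : Fin n → ℝ) : ℝ :=
  (H x).toReal * w x

/-- Almost everywhere on the set where `H` is infinite the weight `w` vanishes, so the convention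
`(∞).toReal = 0` is harmless. -/
theorem ofReal_mulWeight_ae_eq {w : (Fin n → ℝ) → ℝ} (hw : IsWeight w)
    {H : (Fin n → ℝ) → ℝ≥0∞} (hfin : ∀ᵐ x ∂(wMeasure w), H x ≠ ∞) :
    (fun x => ENNReal.ofReal (mulWeight w H x)) =ᵐ[volume] fun x => ENNReal.ofReal (w x) * H x := by
  filter_upwards [hw.ae_ne_top hfin] with x hx
  rw [mulWeight, ENNReal.ofReal_mul ENNReal.toReal_nonneg, mul_comm]
  by_cases h0 : ENNReal.ofReal (w x) = 0
  · rw [h0, zero_mul, zero_mul]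
  · rw [ENNReal.ofReal_toReal (hx h0)]

theorem setLIntegral_mulWeight {w : (Fin n → ℝ) → ℝ} (hw : IsWeight w)
    {H : (Fin n → ℝ) → ℝ≥0∞} (hH : AEMeasurable H volume)
    (hfin : ∀ᵐ x ∂(wMeasure w), H x ≠ ∞) {s : Set (Fin n → ℝ)} (hs : MeasurableSet s) :
    ∫⁻ x in s, ENNReal.ofReal (mulWeight w H x) = ∫⁻ x in s, H x ∂(wMeasure w) := by
  rw [lintegral_wMeasure hw hH hs]
  exact lintegral_congr_ae (ae_restrict_of_ae (ofReal_mulWeight_ae_eq hw hfin))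

theorem isWeight_mulWeight {w : (Fin n → ℝ) → ℝ} (hw : IsWeight w) {H : (Fin n → ℝ) → ℝ≥0∞}
    (hH : AEMeasurable H volume) {σ : ℝ} (hσ : 1 ≤ σ)
    (hHσ : ∫⁻ x, H x ^ σ ∂(wMeasure w) ≠ ∞) (hfin : ∀ᵐ x ∂(wMeasure w), H x ≠ ∞) :
    IsWeight (mulWeight w H) := by
  refine ⟨fun x => mul_nonneg ENNReal.toReal_nonneg (hw.nonneg x), fun x => ?_⟩
  refine ⟨Metric.closedBall x 1, Metric.closedBall_mem_nhds x one_pos, ?_, ?_⟩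
  · exact (hH.ennreal_toReal.mul hw.aemeasurable).aestronglyMeasurable.restrict
  · rw [hasFiniteIntegral_iff_ofReal (f := mulWeight w H) (ae_of_all _ fun y =>
      mul_nonneg ENNReal.toReal_nonneg (hw.nonneg y)),
      setLIntegral_mulWeight hw hH hfin Metric.isClosed_closedBall.measurableSet]
    calc ∫⁻ y in Metric.closedBall x 1, H y ∂(wMeasure w)
        ≤ ∫⁻ y in Metric.closedBall x 1, (1 + H y ^ σ) ∂(wMeasure w) := by
          refine lintegral_mono fun y => ?_
          rcases le_total (H y) 1 with h | h
          · exact h.trans le_self_add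
          · refine le_trans ?_ le_add_self
            simpa using ENNReal.rpow_le_rpow_of_exponent_le h hσ
      _ = wMeasure w (Metric.closedBall x 1) +
            ∫⁻ y in Metric.closedBall x 1, H y ^ σ ∂(wMeasure w) := by
          rw [lintegral_add_left measurable_const, setLIntegral_const, one_mul]
      _ < ∞ := ENNReal.add_lt_top.2 ⟨wMeasure_closedBall_lt_top hw x 1,
          (setLIntegral_le_lintegral _ _).trans_lt hHσ.lt_top⟩

/-- Hölder type inequality: a gauge bound for `w` and an Orlicz bound for `H` with respect to
`w dx` give an Orlicz bound for `H w`. -/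
theorem setLIntegral_young_mulWeight_le {Φ : ℝ → ℝ} (hΦ : IsYoung Φ) {G : ℝ → ℝ≥0∞}
    {A : ℝ≥0∞ → ℝ≥0∞} (hA : Monotone A)
    (hG : ∀ x y : ℝ, 0 ≤ x → 0 ≤ y →
      ENNReal.ofReal (Φ (x * y)) ≤ G y + ENNReal.ofReal y * A (ENNReal.ofReal x))
    {K : ℝ} (hK : 1 ≤ K) {w : (Fin n → ℝ) → ℝ} (hw : IsWeight w) (hGB : GaugeBound G K w)
    {H : (Fin n → ℝ) → ℝ≥0∞} (hH : Measurable H) {c : Fin n → ℝ} {ρ m t : ℝ} (hρ : 0 < ρ)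
    (hm : 0 < m) (ht : 0 < t)
    (hmQ : wMeasure w (Metric.closedBall c ρ) =
      ENNReal.ofReal m * volume (Metric.closedBall c ρ))
    (hHt : ∫⁻ x in Metric.closedBall c ρ, A (H x / ENNReal.ofReal t) ∂(wMeasure w) ≤
      wMeasure w (Metric.closedBall c ρ)) :
    ∫⁻ x in Metric.closedBall c ρ, ENNReal.ofReal (Φ (|mulWeight w H x| / (2 * K * t * m))) ≤
      volume (Metric.closedBall c ρ) := by
  set Q := Metric.closedBall c ρ
  have hK0 : 0 < K := by linarith
  have hAm : Measurable fun x => A (H x / ENNReal.ofReal t) :=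
    hA.measurable.comp (hH.div_const _)
  have hpt : ∀ x, ENNReal.ofReal (Φ (|mulWeight w H x| / (2 * K * t * m))) ≤
      ENNReal.ofReal 2⁻¹ * (G (w x / (K * m)) +
        ENNReal.ofReal (K * m)⁻¹ * (ENNReal.ofReal (w x) * A (H x / ENNReal.ofReal t))) := by
    intro x
    have hw0 := hw.nonneg x
    -- Convexity pulls out the factor `2⁻¹`, which compensates for the two terms of the Young type
    -- inequality, each of integral at most `volume Q`.
    have h1 : |mulWeight w H x| / (2 * K * t * m) =
        2⁻¹ * ((H x).toReal / t * (w x / (K * m))) := by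
      rw [mulWeight, abs_of_nonneg (mul_nonneg ENNReal.toReal_nonneg hw0)]
      field_simp
    have h2 : ENNReal.ofReal ((H x).toReal / t) ≤ H x / ENNReal.ofReal t := by
      rw [ENNReal.ofReal_div_of_pos ht]
      gcongr
      exact ENNReal.ofReal_toReal_le
    have hx0 : 0 ≤ (H x).toReal / t := div_nonneg ENNReal.toReal_nonneg ht.le
    have hy0 : 0 ≤ w x / (K * m) := by positivity
    calc ENNReal.ofReal (Φ (|mulWeight w H x| / (2 * K * t * m)))
        ≤ ENNReal.ofReal (2⁻¹ * Φ ((H x).toReal / t * (w x / (K * m)))) := by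
          rw [h1]
          exact ENNReal.ofReal_le_ofReal
            (hΦ.le_mul (mul_nonneg hx0 hy0) (by norm_num) (by norm_num))
      _ = ENNReal.ofReal 2⁻¹ * ENNReal.ofReal (Φ ((H x).toReal / t * (w x / (K * m)))) :=
          ENNReal.ofReal_mul (by norm_num)
      _ ≤ ENNReal.ofReal 2⁻¹ * (G (w x / (K * m)) + ENNReal.ofReal (w x / (K * m)) *
            A (H x / ENNReal.ofReal t)) := by
          refine mul_le_mul_right ((hG _ _ hx0 hy0).trans ?_) _
          gcongr
          exact hA h2
      _ = _ := by
          rw [div_eq_inv_mul, ENNReal.ofReal_mul (p := (K * m)⁻¹) (by positivity), mul_assoc]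
  have hmeas : AEMeasurable (fun x => ENNReal.ofReal (K * m)⁻¹ *
      (ENNReal.ofReal (w x) * A (H x / ENNReal.ofReal t))) (volume.restrict Q) :=
    ((hw.aemeasurable.ennreal_ofReal.mul hAm.aemeasurable).const_mul _).restrict
  calc _ ≤ ∫⁻ x in Q, ENNReal.ofReal 2⁻¹ * (G (w x / (K * m)) +
        ENNReal.ofReal (K * m)⁻¹ * (ENNReal.ofReal (w x) * A (H x / ENNReal.ofReal t))) :=
        lintegral_mono hpt
    _ = ENNReal.ofReal 2⁻¹ * ((∫⁻ x in Q, G (w x / (K * m))) + ENNReal.ofReal (K * m)⁻¹ *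
          ∫⁻ x in Q, A (H x / ENNReal.ofReal t) ∂(wMeasure w)) := by
        rw [lintegral_const_mul' _ _ ENNReal.ofReal_ne_top, lintegral_add_right' _ hmeas,
          lintegral_const_mul' _ _ ENNReal.ofReal_ne_top,
          lintegral_wMeasure hw hAm.aemeasurable Metric.isClosed_closedBall.measurableSet]
    _ ≤ ENNReal.ofReal 2⁻¹ * (volume Q + ENNReal.ofReal (K * m)⁻¹ *
          (ENNReal.ofReal m * volume Q)) := by
        gcongr
        · exact hGB c ρ m hρ hm hmQ
        · exact hHt.trans hmQ.le
    _ ≤ ENNReal.ofReal 2⁻¹ * (volume Q + volume Q) := by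
        gcongr
        rw [← mul_assoc, ← ENNReal.ofReal_mul (by positivity)]
        refine mul_le_of_le_one_left zero_le (ENNReal.ofReal_le_one.2 ?_)
        rw [mul_inv, mul_assoc, inv_mul_cancel₀ hm.ne', mul_one]
        exact inv_le_one_of_one_le₀ hK
    _ = volume Q := by
        rw [← two_mul, ← mul_assoc, ENNReal.ofReal_inv_of_pos (by norm_num), ENNReal.ofReal_ofNat,
          ENNReal.inv_mul_cancel (by simp) (by simp), one_mul]

/-- If the maximal operator acts boundedly on `H` then `H w` is in `RH_Φ`. -/
theorem rhConst_mulWeight_le {Φ : ℝ → ℝ} (hΦ : IsYoung Φ) {G : ℝ → ℝ≥0∞}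
    {A : ℝ≥0∞ → ℝ≥0∞} (hA : Monotone A)
    (hG : ∀ x y : ℝ, 0 ≤ x → 0 ≤ y →
      ENNReal.ofReal (Φ (x * y)) ≤ G y + ENNReal.ofReal y * A (ENNReal.ofReal x))
    {K : ℝ} (hK : 1 ≤ K) {w : (Fin n → ℝ) → ℝ} (hw : IsWeight w) (hGB : GaugeBound G K w)
    {H : (Fin n → ℝ) → ℝ≥0∞} (hH : Measurable H) (hfin : ∀ᵐ x ∂(wMeasure w), H x ≠ ∞)
    (hW : IsWeight (mulWeight w H)) {B : ℝ} (hB : 0 < B)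
    (hmax : ∀ x, orliczMaximal (wMeasure w) A H x ≤ ENNReal.ofReal B * H x) :
    rhConst Φ (mulWeight w H) ≤ ENNReal.ofReal (4 * K * B) := by
  refine iSup_le fun a => iSup_le fun l => iSup_le fun hl => ?_
  rw [cube_eq_closedBall a hl]
  generalize (fun i => a i + l / 2) = c
  have hρ : 0 < l / 2 := by positivity
  generalize l / 2 = ρ at hρ
  set Q := Metric.closedBall c ρ with hQ
  have hQm : MeasurableSet Q := Metric.isClosed_closedBall.measurableSet
  rw [setLAverage_eq, setLIntegral_mulWeight hw hH.aemeasurable hfin hQm]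
  have hV0 := volume_closedBall_ne_zero c hρ
  have hVt := volume_closedBall_ne_top c ρ
  have hWQ := setLIntegral_mulWeight hw hH.aemeasurable hfin hQm
  -- If `H w` vanishes a.e. on `Q`, every positive level is admissible, so the Orlicz norm is `0`
  -- and the convention `0⁻¹ * 0 = 0` applies.
  by_cases hP0 : wMeasure (mulWeight w H) Q = 0
  · have h0 : ∀ᵐ x ∂(volume.restrict Q), mulWeight w H x = 0 := by
      rw [wMeasure_apply, lintegral_eq_zero_iff' hW.aemeasurable.ennreal_ofReal.restrict] at hP0
      filter_upwards [hP0] with x hx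
      exact le_antisymm (ENNReal.ofReal_eq_zero.1 hx) (hW.nonneg x)
    have hnorm : orliczNorm Φ Q (mulWeight w H) = 0 := by
      refine le_antisymm (ENNReal.le_of_forall_pos_le_add fun ε hε _ => ?_) zero_le
      refine iInf₂_le_of_le (ε : ℝ) ⟨NNReal.coe_pos.2 hε, ?_⟩ (by simp)
      rw [setLAverage_eq, lintegral_congr_ae (g := fun _ => 0)]
      · simp
      · filter_upwards [h0] with x hx
        simp [hx, hΦ.map_zero]
    rw [hnorm, mul_zero]
    exact zero_le
  · have hw0 : wMeasure w Q ≠ 0 := by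
      intro h
      rw [wMeasure_apply, hWQ, setLIntegral_measure_zero _ _ h] at hP0
      exact hP0 rfl
    obtain ⟨m, hm, hmQ⟩ := exists_average hw c hρ hw0
    obtain ⟨P, hP, hPQ⟩ := exists_average hW c hρ hP0
    rw [wMeasure_apply, hWQ] at hPQ
    -- The average of `H` over `Q` with respect to `w dx` is `P / m`, so `H` is below twice this at
    -- some point. There the maximal function is below `2 B P / m`, which is thus an admissible
    -- level for `H` on `Q`.
    obtain ⟨x, hx, hxt⟩ : ∃ x ∈ Metric.ball c ρ,
        ENNReal.ofReal B * H x < ENNReal.ofReal (2 * B * P / m) := by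
      by_contra! hcon
      have hge : ∀ x ∈ Metric.ball c ρ, ENNReal.ofReal (2 * P / m) ≤ H x := fun x hx => by
        refine (ENNReal.mul_le_mul_iff_right (a := ENNReal.ofReal B) (by simpa using hB)
          ENNReal.ofReal_ne_top).1 (le_trans (le_of_eq ?_) (hcon x hx))
        rw [← ENNReal.ofReal_mul hB.le]
        congr 1
        ring
      have h1 : ENNReal.ofReal (2 * P) * volume Q ≤ ENNReal.ofReal P * volume Q := by
        calc ENNReal.ofReal (2 * P) * volume Q
            = ENNReal.ofReal (2 * P / m) * wMeasure w (Metric.ball c ρ) := by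
              rw [wMeasure_ball w c hρ, hmQ, ← mul_assoc, ← ENNReal.ofReal_mul (by positivity),
                div_mul_cancel₀ _ hm.ne']
          _ = ∫⁻ _ in Metric.ball c ρ, ENNReal.ofReal (2 * P / m) ∂(wMeasure w) :=
              (setLIntegral_const _ _).symm
          _ ≤ ∫⁻ x in Metric.ball c ρ, H x ∂(wMeasure w) :=
              setLIntegral_mono' Metric.isOpen_ball.measurableSet hge
          _ ≤ ∫⁻ x in Q, H x ∂(wMeasure w) := lintegral_mono_set Metric.ball_subset_closedBall
          _ = ENNReal.ofReal P * volume Q := hPQ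
      have h2 := (ENNReal.mul_le_mul_iff_left hV0 hVt).1 h1
      rw [ENNReal.ofReal_le_ofReal_iff hP.le] at h2
      linarith
    have hHt := setLIntegral_le_of_orliczMaximal_lt ((hmax x).trans_lt hxt) hx
    have hkey := setLIntegral_young_mulWeight_le hΦ hA hG hK hw hGB hH hρ hm
      (t := 2 * B * P / m) (by positivity) hmQ hHt
    have hc : 2 * K * (2 * B * P / m) * m = 4 * K * B * P := by
      field_simp
      norm_num
    rw [hc] at hkey
    have hnorm : orliczNorm Φ Q (mulWeight w H) ≤ ENNReal.ofReal (4 * K * B * P) := by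
      refine iInf₂_le _ ⟨by positivity, ?_⟩
      rw [setLAverage_eq]
      exact ENNReal.div_le_of_le_mul (by rwa [one_mul])
    rw [hPQ, ENNReal.mul_div_cancel_right hV0 hVt]
    calc _ ≤ (ENNReal.ofReal P)⁻¹ * ENNReal.ofReal (4 * K * B * P) := by gcongr
      _ = ENNReal.ofReal (4 * K * B) := by
        rw [← ENNReal.ofReal_inv_of_pos hP, ← ENNReal.ofReal_mul (by positivity)]
        congr 1
        field_simp

end Weights

/-! ### The gauge attached to a Young function: growth and Young type inequalities. -/

/-- The function `x ↦ Φ (x ^ β) / x ^ β` on `[0, ∞]`. -/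
noncomputable def youngRatio (Φ : ℝ → ℝ) (β : ℝ) (x : ℝ≥0∞) : ℝ≥0∞ :=
  open Classical in
  if x = ∞ then ∞ else ENNReal.ofReal (Φ (x.toReal ^ β) / x.toReal ^ β)

theorem IsYoung.div_le_div {Φ : ℝ → ℝ} (hΦ : IsYoung Φ) {s t : ℝ} (hs : 0 ≤ s) (hst : s ≤ t) :
    Φ s / s ≤ Φ t / t := by
  rcases hs.eq_or_lt with rfl | hs
  · simpa using div_nonneg (hΦ.nonneg t hst) hst
  have ht : 0 < t := hs.trans_le hst
  have h := hΦ.le_mul ht.le (div_nonneg hs.le ht.le) ((div_le_one ht).2 hst)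
  rw [div_mul_cancel₀ _ ht.ne'] at h
  rw [div_le_iff₀ hs]
  calc Φ s ≤ s / t * Φ t := h
    _ = Φ t / t * s := by ring

theorem youngRatio_mono {Φ : ℝ → ℝ} (hΦ : IsYoung Φ) {β : ℝ} (hβ : 0 ≤ β) :
    Monotone (youngRatio Φ β) := by
  intro x y hxy
  unfold youngRatio
  by_cases hy : y = ∞
  · simp [hy]
  have hx : x ≠ ∞ := ne_top_of_le_ne_top hy hxy
  rw [if_neg hx, if_neg hy]
  exact ENNReal.ofReal_le_ofReal (hΦ.div_le_div (Real.rpow_nonneg ENNReal.toReal_nonneg _)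
    (Real.rpow_le_rpow ENNReal.toReal_nonneg (ENNReal.toReal_mono hy hxy) hβ))

/-- The gauge `A (x) = x Φ (x ^ β) / x ^ β`. -/
noncomputable def youngGauge (Φ : ℝ → ℝ) (β : ℝ) (x : ℝ≥0∞) : ℝ≥0∞ := x * youngRatio Φ β x

theorem youngGauge_mono {Φ : ℝ → ℝ} (hΦ : IsYoung Φ) {β : ℝ} (hβ : 0 ≤ β) :
    Monotone (youngGauge Φ β) := fun _ _ h => mul_le_mul' h (youngRatio_mono hΦ hβ h)

theorem youngGauge_ofReal {Φ : ℝ → ℝ} {β x : ℝ} (hx : 0 ≤ x) :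
    youngGauge Φ β (ENNReal.ofReal x) = ENNReal.ofReal (x * (Φ (x ^ β) / x ^ β)) := by
  rw [youngGauge, youngRatio, if_neg ENNReal.ofReal_ne_top, ENNReal.toReal_ofReal hx,
    ENNReal.ofReal_mul hx]

/-- The `B_s` condition in discrete form. -/
theorem tsum_ofReal_young_lt_top {s : ℝ} {Φ : ℝ → ℝ} (hΦ : MemB s Φ) {b : ℝ} (hb : 1 < b) :
    ∑' k : ℕ, ENNReal.ofReal (Φ (b ^ k) / (b ^ k) ^ s) < ∞ := by
  have hb0 : 0 < b := by linarith
  have hs : 0 < s := by linarith [hΦ.one_lt]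
  set C : ℝ := b * b ^ s / (b - 1) with hC
  have hterm : ∀ k : ℕ, ENNReal.ofReal (Φ (b ^ k) / (b ^ k) ^ s) ≤
      ENNReal.ofReal C *
        ∫⁻ t in Ioc (b ^ k) (b ^ (k + 1)), ENNReal.ofReal (Φ t / t ^ s / t) := by
    intro k
    set v := b ^ k with hv
    have hv0 : 0 < v := by positivity
    have hvb : b ^ (k + 1) = b * v := by rw [pow_succ, mul_comm]
    rw [hvb]
    -- On one dyadic-type interval `Φ` is bounded below at the left end and the powers of `t` above
    -- at the right end; `C` is exactly the ratio lost.
    have hlow : ∀ t ∈ Ioc v (b * v),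
        ENNReal.ofReal (Φ v / (b * v) ^ s / (b * v)) ≤ ENNReal.ofReal (Φ t / t ^ s / t) := by
      intro t ht
      have ht0 : 0 < t := hv0.trans ht.1
      refine ENNReal.ofReal_le_ofReal ?_
      have h1 : Φ v ≤ Φ t := hΦ.young.mono (mem_Ici.2 hv0.le) (mem_Ici.2 ht0.le) ht.1.le
      have h2 : 0 ≤ Φ v := hΦ.young.nonneg v hv0.le
      have h3 : t ≤ b * v := ht.2
      have h4 : 0 ≤ Φ t := h2.trans h1
      gcongr
    have hbv : 0 ≤ b * v - v := by nlinarith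
    calc ENNReal.ofReal (Φ v / v ^ s)
        = ENNReal.ofReal C * (ENNReal.ofReal (Φ v / (b * v) ^ s / (b * v)) *
            ENNReal.ofReal (b * v - v)) := by
          have h2 : 0 ≤ Φ v := hΦ.young.nonneg v hv0.le
          have h3 : 0 < b - 1 := by linarith
          rw [← ENNReal.ofReal_mul (by positivity), ← ENNReal.ofReal_mul (by positivity)]
          congr 1
          rw [hC, Real.mul_rpow hb0.le hv0.le]
          have h4 : 0 < b ^ s := by positivity
          have h5 : 0 < v ^ s := by positivity
          have h6 : b * v - v = v * (b - 1) := by ring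
          rw [h6]
          field_simp
      _ = ENNReal.ofReal C *
            ∫⁻ _ in Ioc v (b * v), ENNReal.ofReal (Φ v / (b * v) ^ s / (b * v)) := by
          rw [setLIntegral_const, Real.volume_Ioc]
      _ ≤ _ := by
          gcongr 1
          exact setLIntegral_mono' measurableSet_Ioc hlow
  have hmono : Monotone fun k : ℕ => b ^ k := pow_right_mono₀ hb.le
  calc ∑' k : ℕ, ENNReal.ofReal (Φ (b ^ k) / (b ^ k) ^ s)
      ≤ ∑' k : ℕ, ENNReal.ofReal C *
          ∫⁻ t in Ioc (b ^ k) (b ^ (k + 1)), ENNReal.ofReal (Φ t / t ^ s / t) :=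
        ENNReal.tsum_le_tsum hterm
    _ = ENNReal.ofReal C *
          ∫⁻ t in ⋃ k : ℕ, Ioc (b ^ k) (b ^ (k + 1)), ENNReal.ofReal (Φ t / t ^ s / t) := by
        rw [ENNReal.tsum_mul_left,
          lintegral_iUnion (s := fun k : ℕ => Ioc (b ^ k) (b ^ (k + 1)))
            (fun _ => measurableSet_Ioc) hmono.pairwise_disjoint_on_Ioc_succ]
    _ ≤ ENNReal.ofReal C * ∫⁻ t in Ioi 1, ENNReal.ofReal (Φ t / t ^ s / t) := by
        gcongr
        exact iUnion_subset fun k t ht => (one_le_pow₀ hb.le).trans_lt ht.1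
    _ < ∞ := ENNReal.mul_lt_top ENNReal.ofReal_lt_top hΦ.integrable.lintegral_lt_top

/-- With `v = u^β` one has `u^(-σ) A(u) = u^(1 - σ - β) Φ(v)`, and the relation between `σ`, `β` and
`s` makes the power of `u` equal to `v^(-s)`. -/
theorem two_pow_rpow_mul_youngGauge {s σ β : ℝ} (hσ : σ - 1 = β * (s - 1)) (Φ : ℝ → ℝ) (k : ℕ) :
    ((2 : ℝ≥0∞) ^ (-(k : ℤ))) ^ σ * youngGauge Φ β (2 ^ (k : ℤ)) =
      ENNReal.ofReal (Φ (((2 : ℝ) ^ β) ^ k) / (((2 : ℝ) ^ β) ^ k) ^ s) := by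
  set u : ℝ := 2 ^ k with hu
  have hu0 : 0 < u := by positivity
  have h1 : (2 : ℝ≥0∞) ^ (k : ℤ) = ENNReal.ofReal u := by
    rw [zpow_natCast, hu, ENNReal.ofReal_pow (by norm_num), ENNReal.ofReal_ofNat]
  have h2 : (2 : ℝ≥0∞) ^ (-(k : ℤ)) = ENNReal.ofReal u⁻¹ := by
    rw [ENNReal.ofReal_inv_of_pos hu0, ← h1, zpow_natCast, ENNReal.zpow_neg, zpow_natCast]
  have h3 : ((2 : ℝ) ^ β) ^ k = u ^ β := by
    rw [hu, ← Real.rpow_natCast, ← Real.rpow_mul (by norm_num), mul_comm, Real.rpow_mul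
      (by norm_num), Real.rpow_natCast]
  rw [h1, h2, h3, youngGauge_ofReal hu0.le, ENNReal.ofReal_rpow_of_pos (by positivity),
    ← ENNReal.ofReal_mul (by positivity)]
  congr 1
  have h4 : u ^ (σ - 1) = (u ^ β) ^ (s - 1) := by rw [hσ, Real.rpow_mul hu0.le]
  rw [Real.inv_rpow hu0.le]
  rw [Real.rpow_sub_one hu0.ne', Real.rpow_sub_one (by positivity)] at h4
  have h5 : 0 < u ^ σ := by positivity
  have h6 : 0 < u ^ β := by positivity
  have h7 : 0 < (u ^ β) ^ s := by positivity
  rw [div_eq_div_iff hu0.ne' h6.ne'] at h4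
  rw [eq_div_iff h7.ne']
  field_simp
  linear_combination (-Φ (u ^ β)) * h4

theorem upperPart_le (A : ℝ≥0∞ → ℝ≥0∞) (x : ℝ≥0∞) : upperPart A x ≤ A x := by
  unfold upperPart
  split_ifs
  · exact le_rfl
  · exact zero_le

/-- Non-negative indices give the discrete `B_s` series with ratio `2^β`. For negative ones, `A(x) ≤
x * youngRatio Φ β 1` when `x ≤ 1`, so the gauge is eventually at most `1 / 2` and `upperPart`
leaves finitely many terms. -/
theorem dyadicGrowth_youngGauge_ne_top {s σ β : ℝ} {Φ : ℝ → ℝ} (hΦ : MemB s Φ) (hβ : 0 < β)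
    (hσ : σ - 1 = β * (s - 1)) : dyadicGrowth (youngGauge Φ β) σ ≠ ∞ := by
  have hσ0 : 0 < σ := by nlinarith [mul_pos hβ (sub_pos.2 hΦ.one_lt)]
  rw [dyadicGrowth, tsum_of_nat_of_neg_add_one ENNReal.summable ENNReal.summable]
  refine ENNReal.add_ne_top.2 ⟨?_, ?_⟩
  · refine ne_top_of_le_ne_top (tsum_ofReal_young_lt_top hΦ
      (Real.one_lt_rpow (by norm_num : (1 : ℝ) < 2) hβ)).ne (ENNReal.tsum_le_tsum fun k => ?_)
    rw [← two_pow_rpow_mul_youngGauge hσ Φ k]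
    exact mul_le_mul_right (upperPart_le _ _) _
  · obtain ⟨N, hN⟩ : ∃ N : ℕ, youngRatio Φ β 1 < (2 : ℝ≥0∞) ^ N := by
      have h1 : youngRatio Φ β 1 ≠ ∞ := by simp [youngRatio]
      obtain ⟨N, hN⟩ := ENNReal.exists_nat_gt h1
      exact ⟨N, hN.trans (by exact_mod_cast Nat.lt_two_pow_self)⟩
    have hsmall : ∀ k : ℕ, (2 : ℝ≥0∞) ^ (-((k : ℤ) + 1)) ≤ 1 := fun k => by
      rw [ENNReal.zpow_neg, ENNReal.inv_le_one]
      exact_mod_cast one_le_pow₀ (M₀ := ℝ≥0∞) (n := k + 1) one_le_two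
    rw [tsum_eq_sum (s := Finset.range N)]
    · refine (ENNReal.sum_lt_top.2 fun k _ => ENNReal.mul_lt_top ?_ ?_).ne
      · exact ENNReal.rpow_lt_top_of_nonneg hσ0.le
          (ENNReal.zpow_ne_top (by simp) (by simp) _)
      · refine (upperPart_le _ _).trans_lt (ENNReal.mul_lt_top
          ((hsmall k).trans_lt ENNReal.one_lt_top) ?_)
        refine (youngRatio_mono hΦ.young hβ.le (hsmall k)).trans_lt (hN.trans (by simp))
    · intro k hk
      have hk' : N ≤ k := by simpa using hk
      have hle : youngGauge Φ β ((2 : ℝ≥0∞) ^ (-((k : ℤ) + 1))) ≤ 2⁻¹ := by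
        calc youngGauge Φ β ((2 : ℝ≥0∞) ^ (-((k : ℤ) + 1)))
            ≤ (2 : ℝ≥0∞) ^ (-((k : ℤ) + 1)) * 2 ^ k := by
              refine mul_le_mul_right ?_ _
              exact (youngRatio_mono hΦ.young hβ.le (hsmall k)).trans
                (hN.le.trans (pow_le_pow_right₀ one_le_two hk'))
          _ = 2⁻¹ := by
              rw [← zpow_natCast, ← ENNReal.zpow_add (by simp) (by simp)]
              have : -((k : ℤ) + 1) + k = -1 := by ring
              rw [this, ENNReal.zpow_neg, zpow_one]
      rw [upperPart, if_neg hle.not_gt, mul_zero]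

/-- Young type inequality in the range where the product is controlled by the first factor. -/
theorem ofReal_young_mul_le {Φ : ℝ → ℝ} (hΦ : IsYoung Φ) {β x y : ℝ} (hx : 0 ≤ x) (hy : 0 ≤ y)
    (hxy : x * y ≤ x ^ β) :
    ENNReal.ofReal (Φ (x * y)) ≤
      ENNReal.ofReal y * youngGauge Φ β (ENNReal.ofReal x) := by
  rcases hx.eq_or_lt with rfl | hx
  · simp [hΦ.map_zero]
  rw [youngGauge_ofReal hx.le, ← ENNReal.ofReal_mul hy]
  refine ENNReal.ofReal_le_ofReal ?_
  have hp : 0 < x ^ β := by positivity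
  have h := hΦ.le_mul hp.le (div_nonneg (mul_nonneg hx.le hy) hp.le) ((div_le_one hp).2 hxy)
  rw [div_mul_cancel₀ _ hp.ne'] at h
  calc Φ (x * y) ≤ x * y / x ^ β * Φ (x ^ β) := h
    _ = _ := by ring

/-- Young type inequality `Φ (x y) ≤ Ψ (y) + y A (x)` for `Φ (t) = Ψ (t ^ r)`. -/
theorem ofReal_young_mul_le_add {Φ Ψ : ℝ → ℝ} (hΦ : IsYoung Φ) {r : ℝ} (hr : 0 < r) (hr1 : r < 1)
    (hΨ : ∀ t : ℝ, 0 ≤ t → Φ t = Ψ (t ^ r)) {x y : ℝ} (hx : 0 ≤ x) (hy : 0 ≤ y) :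
    ENNReal.ofReal (Φ (x * y)) ≤ ENNReal.ofReal (Ψ y) +
      ENNReal.ofReal y * youngGauge Φ (1 - r)⁻¹ (ENNReal.ofReal x) := by
  rcases le_or_gt (x * y) (x ^ (1 - r)⁻¹) with h | h
  · exact (ofReal_young_mul_le hΦ hx hy h).trans le_add_self
  -- For positive `x`, here `y > x^(r / (1 - r))`; writing `y = u^r` gives `x ≤ u^(1 - r)`, hence `x
  -- y ≤ u` and `Φ (x y) ≤ Φ u = Ψ y`.
  refine le_trans (ENNReal.ofReal_le_ofReal ?_) le_self_add
  have h1r : 0 < 1 - r := by linarith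
  obtain ⟨u, hu, rfl⟩ : ∃ u : ℝ, 0 ≤ u ∧ u ^ r = y :=
    ⟨y ^ r⁻¹, by positivity, Real.rpow_inv_rpow hy hr.ne'⟩
  rw [← hΨ u hu]
  refine hΦ.mono (mem_Ici.2 (mul_nonneg hx hy)) (mem_Ici.2 hu) ?_
  rcases hx.eq_or_lt with rfl | hx
  · simpa using hu
  rcases hu.eq_or_lt with rfl | hu
  · simp [Real.zero_rpow hr.ne']
  have hxu : x ≤ u ^ (1 - r) := by
    by_contra! hlt
    have h2 : u < x ^ (1 - r)⁻¹ := by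
      have := Real.rpow_lt_rpow (by positivity) hlt (inv_pos.2 h1r)
      rwa [Real.rpow_rpow_inv hu.le h1r.ne'] at this
    have h3 : u ^ r < (x ^ (1 - r)⁻¹) ^ r := Real.rpow_lt_rpow hu.le h2 hr
    have h4 : x * (x ^ (1 - r)⁻¹) ^ r = x ^ (1 - r)⁻¹ := by
      rw [← Real.rpow_mul hx.le]
      nth_rewrite 1 [← Real.rpow_one x]
      rw [← Real.rpow_add hx]
      congr 1
      field_simp
      ring
    nlinarith [mul_lt_mul_of_pos_left h3 hx]
  calc x * u ^ r ≤ u ^ (1 - r) * u ^ r := by gcongr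
    _ = u := by rw [← Real.rpow_add hu, sub_add_cancel, Real.rpow_one]

theorem IsYoung.exists_mul_le {Φ : ℝ → ℝ} (hΦ : IsYoung Φ) (M : ℝ) :
    ∃ L : ℝ, 1 ≤ L ∧ ∀ y, L ≤ y → M * y ≤ Φ y := by
  obtain ⟨L, hL⟩ := eventually_atTop.1 (hΦ.superlinear.eventually_ge_atTop M)
  refine ⟨max L 1, le_max_right _ _, fun y hy => ?_⟩
  have hy0 : 0 < y := by linarith [le_max_right L 1]
  exact (le_div_iff₀ hy0).1 (hL y ((le_max_left _ _).trans hy))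

/-- Since `Ψ (y) = Φ (y^(1/r))` with `1 / r > 1`, `Ψ` dominates `Φ` on `[1, ∞)` and inherits its
superlinearity. -/
theorem exists_forall_ofReal_mul_le {Φ Ψ : ℝ → ℝ} (hΦ : IsYoung Φ) {r : ℝ} (hr : 0 < r)
    (hr1 : r < 1) (hΨ : ∀ t : ℝ, 0 ≤ t → Φ t = Ψ (t ^ r)) (M : ℝ) :
    ∃ L : ℝ, ∀ y, L ≤ y → ENNReal.ofReal (M * y) ≤ ENNReal.ofReal (Ψ y) := by
  obtain ⟨L, hL1, hL⟩ := hΦ.exists_mul_le M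
  refine ⟨L, fun y hy => ENNReal.ofReal_le_ofReal ((hL y hy).trans ?_)⟩
  have hy1 : 1 ≤ y := hL1.trans hy
  have hy0 : 0 ≤ y := by linarith
  have h1 : Ψ y = Φ (y ^ r⁻¹) := by
    rw [hΨ _ (by positivity), Real.rpow_inv_rpow hy0 hr.ne']
  rw [h1]
  refine hΦ.mono (mem_Ici.2 hy0) (mem_Ici.2 (by positivity)) ?_
  exact Real.self_le_rpow_of_one_le hy1 ((one_le_inv₀ hr).2 hr1.le)

/-- The gauge of the class `RH_∞`. -/
noncomputable def inftyGauge (y : ℝ) : ℝ≥0∞ := if y ≤ 1 then 0 else ∞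

/-- The limiting case `r = 0`: for `y ≤ 1` the product is at most `x`, and for `y > 1` the right
side is infinite. -/
theorem ofReal_young_mul_le_inftyGauge {Φ : ℝ → ℝ} (hΦ : IsYoung Φ) {x y : ℝ} (hx : 0 ≤ x)
    (hy : 0 ≤ y) : ENNReal.ofReal (Φ (x * y)) ≤ inftyGauge y +
      ENNReal.ofReal y * youngGauge Φ 1 (ENNReal.ofReal x) := by
  unfold inftyGauge
  split_ifs with h
  · rw [zero_add]
    refine ofReal_young_mul_le hΦ hx hy ?_
    rw [Real.rpow_one]
    exact mul_le_of_le_one_right hx h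
  · simp

theorem exists_forall_ofReal_mul_le_inftyGauge (M : ℝ) :
    ∃ L : ℝ, ∀ y, L ≤ y → ENNReal.ofReal (M * y) ≤ inftyGauge y :=
  ⟨2, fun y hy => by rw [inftyGauge, if_neg (by linarith)]; exact le_top⟩

/-! ### From characteristics to gauge bounds and weight majorants. -/

section Weights

variable {n : ℕ}

theorem closedBall_eq_cube (c : Fin n → ℝ) {ρ : ℝ} (hρ : 0 < ρ) :
    Metric.closedBall c ρ = cube (fun i => c i - ρ) (2 * ρ) := by
  rw [cube_eq_closedBall _ (by positivity)]
  congr 1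
  · ext i; ring
  · ring

theorem setLAverage_weight_eq {w : (Fin n → ℝ) → ℝ} {c : Fin n → ℝ} {ρ m : ℝ} (hρ : 0 < ρ)
    (hmQ : wMeasure w (Metric.closedBall c ρ) =
      ENNReal.ofReal m * volume (Metric.closedBall c ρ)) :
    (⨍⁻ x in Metric.closedBall c ρ, ENNReal.ofReal (w x) ∂volume) = ENNReal.ofReal m := by
  rw [setLAverage_eq, ← wMeasure_apply, hmQ, ENNReal.mul_div_cancel_right
    (volume_closedBall_ne_zero c hρ) (volume_closedBall_ne_top c ρ)]

/-- The class `RH_Ψ` in terms of a gauge bound. -/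
theorem gaugeBound_of_rhConst_le {Ψ : ℝ → ℝ} (hΨ : MonotoneOn Ψ (Ici 0)) {K : ℝ≥0}
    {w : (Fin n → ℝ) → ℝ} (hw : IsWeight w) (hK : rhConst Ψ w ≤ K) :
    GaugeBound (fun y => ENNReal.ofReal (Ψ y)) (K + 1) w := by
  intro c ρ m hρ hm hmQ
  set Q := Metric.closedBall c ρ with hQ
  have h1 : (ENNReal.ofReal m)⁻¹ * orliczNorm Ψ Q w ≤ K := by
    rw [← setLAverage_weight_eq hρ hmQ, hQ, closedBall_eq_cube c hρ]
    refine le_trans (le_iSup₂_of_le (fun i => c i - ρ) (2 * ρ) ?_) hK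
    rw [iSup_pos (show 0 < 2 * ρ by positivity)]
  -- Passing from `K` to `K + 1` makes the inequality strict, so some admissible level lies below
  -- `(K + 1) * m`, whether or not the Luxemburg infimum is attained.
  have h2 : orliczNorm Ψ Q w < ENNReal.ofReal ((K + 1) * m) := by
    calc orliczNorm Ψ Q w = ENNReal.ofReal m * ((ENNReal.ofReal m)⁻¹ * orliczNorm Ψ Q w) := by
          rw [← mul_assoc, ENNReal.mul_inv_cancel (by simpa using hm) ENNReal.ofReal_ne_top,
            one_mul]
      _ ≤ ENNReal.ofReal m * K := by gcongr
      _ = ENNReal.ofReal (K * m) := by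
          rw [mul_comm, ENNReal.ofReal_mul K.coe_nonneg, ENNReal.ofReal_coe_nnreal]
      _ < _ := by
          rw [ENNReal.ofReal_lt_ofReal_iff (by positivity)]
          nlinarith
  simp only [orliczNorm, iInf_lt_iff] at h2
  obtain ⟨c', ⟨hc', hint⟩, hlt⟩ := h2
  rw [ENNReal.ofReal_lt_ofReal_iff (by positivity)] at hlt
  rw [setLAverage_eq, ENNReal.div_le_iff_le_mul
    (Or.inl (volume_closedBall_ne_zero c hρ)) (Or.inl (volume_closedBall_ne_top c ρ)),
    one_mul] at hint
  refine (lintegral_mono fun x => ENNReal.ofReal_le_ofReal ?_).trans hint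
  have hwx := hw.nonneg x
  refine hΨ (mem_Ici.2 (by positivity)) (mem_Ici.2 (by positivity)) ?_
  rw [abs_of_nonneg hwx]
  gcongr

/-- The class `RH_∞` in terms of a gauge bound. -/
theorem gaugeBound_of_rhInftyConst_le {K : ℝ≥0} {w : (Fin n → ℝ) → ℝ}
    (hK : rhInftyConst w ≤ K) : GaugeBound inftyGauge (K + 1) w := by
  intro c ρ m hρ hm hmQ
  set Q := Metric.closedBall c ρ with hQ
  have h1 : essSup (fun x => ENNReal.ofReal (w x)) (volume.restrict Q) *
      (ENNReal.ofReal m)⁻¹ ≤ K := by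
    rw [← setLAverage_weight_eq hρ hmQ, hQ, closedBall_eq_cube c hρ]
    refine le_trans (le_iSup₂_of_le (fun i => c i - ρ) (2 * ρ) ?_) hK
    rw [iSup_pos (show 0 < 2 * ρ by positivity)]
  have h2 : essSup (fun x => ENNReal.ofReal (w x)) (volume.restrict Q) ≤
      ENNReal.ofReal (K * m) := by
    rw [ENNReal.ofReal_mul K.coe_nonneg, ENNReal.ofReal_coe_nnreal]
    exact (ENNReal.div_le_iff_le_mul (Or.inl (by simpa using hm))
      (Or.inl ENNReal.ofReal_ne_top)).1 h1
  rw [lintegral_congr_ae (g := fun _ => 0)]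
  · simp
  filter_upwards [ENNReal.ae_le_essSup fun x => ENNReal.ofReal (w x)] with x hx
  have h3 : w x ≤ K * m := by
    rw [← ENNReal.ofReal_le_ofReal_iff (by positivity)]
    exact hx.trans h2
  rw [inftyGauge, if_pos]
  rw [div_le_one (by positivity)]
  nlinarith

/-- Every `h` in `L^σ(w)` has a majorant `H`, of comparable norm, with `H w` in `RH_Φ`. -/
theorem exists_weight_majorant {s σ β : ℝ} {Φ : ℝ → ℝ} (hΦ : MemB s Φ) (hβ : 0 < β)
    (hσ : σ - 1 = β * (s - 1)) {G : ℝ → ℝ≥0∞}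
    (hG : ∀ x y : ℝ, 0 ≤ x → 0 ≤ y → ENNReal.ofReal (Φ (x * y)) ≤
      G y + ENNReal.ofReal y * youngGauge Φ β (ENNReal.ofReal x))
    (hGlin : ∀ M : ℝ, ∃ L : ℝ, ∀ y, L ≤ y → ENNReal.ofReal (M * y) ≤ G y)
    {K : ℝ} (hK : 1 ≤ K) :
    ∃ C K₁ : ℝ≥0, ∀ w : (Fin n → ℝ) → ℝ, IsWeight w → GaugeBound G K w →
      ∀ h : (Fin n → ℝ) → ℝ≥0∞, Measurable h → ∫⁻ x, h x ^ σ ∂(wMeasure w) ≠ ∞ →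
        ∃ H : (Fin n → ℝ) → ℝ≥0∞, Measurable H ∧ (∀ x, h x ≤ H x) ∧
          ∫⁻ x, H x ^ σ ∂(wMeasure w) ≤ C * ∫⁻ x, h x ^ σ ∂(wMeasure w) ∧
          (∀ᵐ x ∂(wMeasure w), H x ≠ ∞) ∧ IsWeight (mulWeight w H) ∧
          rhConst Φ (mulWeight w H) ≤ K₁ := by
  have hσ1 : 1 ≤ σ := by nlinarith [mul_pos hβ (sub_pos.2 hΦ.one_lt)]
  have hσ0 : 0 < σ := by linarith
  have hAmono := youngGauge_mono hΦ.young hβ.le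
  obtain ⟨D, hDtop, hD⟩ := exists_doubling (n := n) (by linarith : 0 < K) hGlin
  set C₁ : ℝ≥0∞ := 2 * D * (4 ^ σ * dyadicGrowth (youngGauge Φ β) σ) with hC₁
  have hC₁top : C₁ ≠ ∞ := ENNReal.mul_ne_top (ENNReal.mul_ne_top (by simp) hDtop)
    (ENNReal.mul_ne_top (ENNReal.rpow_ne_top_of_nonneg hσ0.le (by simp))
      (dyadicGrowth_youngGauge_ne_top hΦ hβ hσ))
  -- The summand `1` keeps `B` non-zero, as the iteration divides by it.
  set B : ℝ≥0∞ := C₁ ^ σ⁻¹ + 1 with hB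
  have hB0 : B ≠ 0 := by simp [hB]
  have hBtop : B ≠ ∞ := ENNReal.add_ne_top.2
    ⟨ENNReal.rpow_ne_top_of_nonneg (inv_nonneg.2 hσ0.le) hC₁top, by simp⟩
  have hC₁B : C₁ ≤ B ^ σ := by
    calc C₁ = (C₁ ^ σ⁻¹) ^ σ := (ENNReal.rpow_inv_rpow hσ0.ne' _).symm
      _ ≤ B ^ σ := ENNReal.rpow_le_rpow le_self_add hσ0.le
  have hBpos : 0 < B.toReal := ENNReal.toReal_pos hB0 hBtop
  refine ⟨(rubioConst σ).toNNReal, (4 * K * (8 * B.toReal)).toNNReal,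
    fun w hw hGB h hm hh => ?_⟩
  have hbound : ∀ h : (Fin n → ℝ) → ℝ≥0∞, Measurable h → ∫⁻ x, h x ^ σ ∂(wMeasure w) ≠ ∞ →
      ∫⁻ x, orliczMaximal (wMeasure w) (fun t => t * youngRatio Φ β t) h x ^ σ ∂(wMeasure w) ≤
        B ^ σ * ∫⁻ x, h x ^ σ ∂(wMeasure w) := fun h hm hh =>
    (lintegral_orliczMaximal_rpow_le (hD w hw hGB) (wMeasure_closedBall_lt_top hw) hAmono
      (by simp [youngGauge]) hσ0 hm hh).trans (mul_le_mul_left hC₁B _)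
  obtain ⟨H, hHm, hhH, hHσ, hmax⟩ := exists_rubio_majorant
    (youngRatio_mono hΦ.young hβ.le) hB0 hBtop hσ0 hbound hm hh
  have hHne : ∫⁻ x, H x ^ σ ∂(wMeasure w) ≠ ∞ :=
    ne_top_of_le_ne_top (ENNReal.mul_ne_top (rubioConst_ne_top hσ0) hh) hHσ
  have hHfin : ∀ᵐ x ∂(wMeasure w), H x ≠ ∞ := by
    filter_upwards [ae_lt_top (hHm.pow_const σ) hHne] with y hy htop
    simp [htop, hσ0] at hy
  have hW := isWeight_mulWeight hw hHm.aemeasurable hσ1 hHne hHfin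
  refine ⟨H, hHm, hhH, ?_, hHfin, hW, ?_⟩
  · rwa [ENNReal.coe_toNNReal (rubioConst_ne_top hσ0)]
  · refine rhConst_mulWeight_le hΦ.young hAmono hG hK hw hGB hHm hHfin hW
      (B := 8 * B.toReal) (by positivity) fun x => ?_
    rw [ENNReal.ofReal_mul (by norm_num), ENNReal.ofReal_toReal hBtop, ENNReal.ofReal_ofNat]
    exact hmax x

/-! ### Duality and the extrapolation step. -/

theorem lintegral_mul_mulWeight {w : (Fin n → ℝ) → ℝ} (hw : IsWeight w)
    {f H : (Fin n → ℝ) → ℝ≥0∞} (hf : AEMeasurable f volume) (hH : AEMeasurable H volume)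
    (hfin : ∀ᵐ x ∂(wMeasure w), H x ≠ ∞) :
    ∫⁻ x, f x * ENNReal.ofReal (mulWeight w H x) = ∫⁻ x, f x * H x ∂(wMeasure w) := by
  have h := lintegral_withDensity_eq_lintegral_mul₀ hw.aemeasurable.ennreal_ofReal (hf.mul hH)
  simp only [Pi.mul_apply] at h
  rw [wMeasure, h]
  refine lintegral_congr_ae ?_
  filter_upwards [ofReal_mulWeight_ae_eq hw hfin] with x hx
  rw [hx]
  ring

theorem lpNorm_eq {w : (Fin n → ℝ) → ℝ} (hw : IsWeight w) {f : (Fin n → ℝ) → ℝ≥0∞}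
    (hf : AEMeasurable f volume) (p : ℝ) :
    lpNorm p w f = (∫⁻ x, f x ^ p ∂(wMeasure w)) ^ (1 / p) := by
  rw [lpNorm, wMeasure, lintegral_withDensity_eq_lintegral_mul₀ hw.aemeasurable.ennreal_ofReal
    (hf.pow_const p)]
  simp only [Pi.mul_apply, mul_comm]

/-- Hölder's inequality in the form used for duality. -/
theorem lintegral_rpow_mul_le (μ : Measure (Fin n → ℝ)) {p₀ p : ℝ} (hp₀ : 0 < p₀) (hp : p₀ < p)
    {f H : (Fin n → ℝ) → ℝ≥0∞} (hf : AEMeasurable f μ) (hH : AEMeasurable H μ) :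
    ∫⁻ x, f x ^ p₀ * H x ∂μ ≤ (∫⁻ x, f x ^ p ∂μ) ^ (p₀ / p) *
      (∫⁻ x, H x ^ (p / (p - p₀)) ∂μ) ^ ((p - p₀) / p) := by
  have hp0 : 0 < p := hp₀.trans hp
  have hpp : 0 < p - p₀ := sub_pos.2 hp
  have hconj : (p / p₀).HolderConjugate (p / (p - p₀)) := by
    refine Real.holderConjugate_iff.2 ⟨(one_lt_div hp₀).2 hp, ?_⟩
    field_simp
    ring
  have h := ENNReal.lintegral_mul_le_Lp_mul_Lq μ hconj (hf.pow_const p₀) hH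
  simp only [Pi.mul_apply, ← ENNReal.rpow_mul, one_div_div, mul_div_cancel₀ p hp₀.ne'] at h
  exact h

/-- One step of extrapolation: passing from `p₀` to `p > p₀` with a weight majorant. -/
theorem lpNorm_le_of_majorant {F : Set (((Fin n → ℝ) → ℝ≥0∞) × ((Fin n → ℝ) → ℝ≥0∞))}
    (hF : IsFamily F) {p₀ p : ℝ} (hp₀ : 0 < p₀) (hp : p₀ < p)
    {char : ((Fin n → ℝ) → ℝ) → ℝ≥0∞} {N : ℝ≥0 → ℝ≥0} (hN : NormIneq F p₀ char N)
    {C K₁ : ℝ≥0} {w : (Fin n → ℝ) → ℝ} (hw : IsWeight w)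
    (hmaj : ∀ h : (Fin n → ℝ) → ℝ≥0∞, Measurable h →
      ∫⁻ x, h x ^ (p / (p - p₀)) ∂(wMeasure w) ≠ ∞ →
        ∃ H : (Fin n → ℝ) → ℝ≥0∞, Measurable H ∧ (∀ x, h x ≤ H x) ∧
          ∫⁻ x, H x ^ (p / (p - p₀)) ∂(wMeasure w) ≤
            C * ∫⁻ x, h x ^ (p / (p - p₀)) ∂(wMeasure w) ∧
          (∀ᵐ x ∂(wMeasure w), H x ≠ ∞) ∧ IsWeight (mulWeight w H) ∧
          char (mulWeight w H) ≤ K₁)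
    {f g : (Fin n → ℝ) → ℝ≥0∞} (hfg : (f, g) ∈ F) (hfin : lpNorm p w f < ∞) :
    lpNorm p w f ≤ (N K₁ * C ^ ((p - p₀) / p / p₀) : ℝ≥0) * lpNorm p w g := by
  obtain ⟨hf, hg⟩ : AEMeasurable f volume ∧ AEMeasurable g volume := hF _ hfg
  have hp0 : 0 < p := hp₀.trans hp
  have hpp : 0 < p - p₀ := sub_pos.2 hp
  have hac : wMeasure w ≪ volume := withDensity_absolutelyContinuous _ _
  set μ := wMeasure w with hμ
  rw [lpNorm_eq hw hf] at hfin ⊢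
  rw [lpNorm_eq hw hg]
  set X := ∫⁻ x, f x ^ p ∂μ with hX
  set Y := ∫⁻ x, g x ^ p ∂μ with hY
  have hXtop : X ≠ ∞ := by
    intro h
    simp [h, hp0] at hfin
  rcases eq_or_ne X 0 with hX0 | hX0
  · rw [hX0, ENNReal.zero_rpow_of_pos (by positivity)]
    exact zero_le
  -- The majorant is built from a Borel measurable function, whereas `f` is only Lebesgue
  -- measurable; the modification is on a null set for `w dx`.
  set f' := hf.mk f with hf'
  have hff' : f =ᵐ[μ] f' := hac.ae_eq hf.ae_eq_mk
  have hhX : ∫⁻ x, (f' x ^ (p - p₀)) ^ (p / (p - p₀)) ∂μ = X := by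
    refine lintegral_congr_ae ?_
    filter_upwards [hff'] with x hx
    rw [hx, ← ENNReal.rpow_mul, mul_div_cancel₀ p hpp.ne']
  obtain ⟨H, hHm, hhH, hHσ, hHfin, hW, hchar⟩ := hmaj (fun x => f' x ^ (p - p₀))
    (hf.measurable_mk.pow_const _) (by rwa [hhX])
  rw [hhX] at hHσ
  have hHolder : ∀ u : (Fin n → ℝ) → ℝ≥0∞, AEMeasurable u volume →
      ∫⁻ x, u x ^ p₀ * H x ∂μ ≤ (∫⁻ x, u x ^ p ∂μ) ^ (p₀ / p) * (C * X) ^ ((p - p₀) / p) :=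
    fun u hu => (lintegral_rpow_mul_le μ hp₀ hp (hu.mono_ac hac) hHm.aemeasurable).trans
      (mul_le_mul_right (ENNReal.rpow_le_rpow hHσ (by positivity)) _)
  have hXle : X ≤ ∫⁻ x, f x ^ p₀ * H x ∂μ := by
    refine lintegral_mono_ae ?_
    filter_upwards [hff'] with x hx
    calc f x ^ p = f x ^ p₀ * f' x ^ (p - p₀) := by
          rw [← hx, ← ENNReal.rpow_add_of_nonneg _ _ hp₀.le hpp.le, add_sub_cancel]
      _ ≤ _ := mul_le_mul_right (hhH x) _
  have hnorm : ∀ u : (Fin n → ℝ) → ℝ≥0∞, AEMeasurable u volume →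
      lpNorm p₀ (mulWeight w H) u = (∫⁻ x, u x ^ p₀ * H x ∂μ) ^ (1 / p₀) := fun u hu => by
    rw [lpNorm, lintegral_mul_mulWeight hw (hu.pow_const p₀) hHm.aemeasurable hHfin]
  have hffin : ∫⁻ x, f x ^ p₀ * H x ∂μ ≠ ∞ := by
    refine ne_top_of_le_ne_top (ENNReal.mul_ne_top ?_ ?_) (hHolder f hf)
    · exact ENNReal.rpow_ne_top_of_nonneg (by positivity) hXtop
    · exact ENNReal.rpow_ne_top_of_nonneg (by positivity)
        (ENNReal.mul_ne_top ENNReal.coe_ne_top hXtop)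
  have hineq := hN K₁ _ hW hchar (f, g) hfg (by
    rw [hnorm f hf]
    exact ENNReal.rpow_lt_top_of_nonneg (by positivity) hffin)
  rw [hnorm f hf, hnorm g hg] at hineq
  have hroot : X ^ (1 / p₀) ≤
      N K₁ * (Y ^ (p₀ / p) * (C * X) ^ ((p - p₀) / p)) ^ (1 / p₀) :=
    (ENNReal.rpow_le_rpow hXle (by positivity)).trans
      (hineq.trans (mul_le_mul_right (ENNReal.rpow_le_rpow (hHolder g hg) (by positivity)) _))
  set θ := (p - p₀) / p / p₀ with hθ
  have hθ0 : 0 ≤ θ := by positivity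
  have hexp : 1 / p₀ = 1 / p + θ := by
    rw [hθ]
    field_simp
    ring
  have hrhs : (Y ^ (p₀ / p) * (C * X) ^ ((p - p₀) / p)) ^ (1 / p₀) =
      Y ^ (1 / p) * C ^ θ * X ^ θ := by
    rw [ENNReal.mul_rpow_of_nonneg _ _ (by positivity), ← ENNReal.rpow_mul, ← ENNReal.rpow_mul,
      show (p - p₀) / p * (1 / p₀) = θ by rw [hθ]; ring,
      show p₀ / p * (1 / p₀) = 1 / p by field_simp,
      ENNReal.mul_rpow_of_nonneg _ _ hθ0, mul_assoc]
  rw [hrhs, hexp, ENNReal.rpow_add_of_nonneg _ _ (by positivity) hθ0, ← mul_assoc] at hroot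
  -- Here `X` non-zero and finite is essential: `X ^ θ`, the surplus in `1 / p₀ = 1 / p + θ`, is
  -- divided out.
  have hcancel := (ENNReal.mul_le_mul_iff_left
    (ENNReal.rpow_pos (pos_iff_ne_zero.2 hX0) hXtop).ne'
    (ENNReal.rpow_ne_top_of_nonneg hθ0 hXtop)).1 hroot
  refine hcancel.trans (le_of_eq ?_)
  rw [ENNReal.coe_mul, ← ENNReal.coe_rpow_of_nonneg _ hθ0]
  ring

end Weights

/-- Extrapolation for a class of weights characterised by a gauge bound. -/
theorem exists_normIneq_of_gaugeBound {n : ℕ} {p₀ p : ℝ} (hp₀ : 0 < p₀) (hp : p₀ < p) {s β : ℝ}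
    {Φ : ℝ → ℝ} (hΦ : MemB s Φ) (hβ : 0 < β) (hσ : p / (p - p₀) - 1 = β * (s - 1))
    {G : ℝ → ℝ≥0∞}
    (hG : ∀ x y : ℝ, 0 ≤ x → 0 ≤ y → ENNReal.ofReal (Φ (x * y)) ≤
      G y + ENNReal.ofReal y * youngGauge Φ β (ENNReal.ofReal x))
    (hGlin : ∀ M : ℝ, ∃ L : ℝ, ∀ y, L ≤ y → ENNReal.ofReal (M * y) ≤ G y)
    {char : ((Fin n → ℝ) → ℝ) → ℝ≥0∞}
    (hchar : ∀ (K : ℝ≥0) (w : (Fin n → ℝ) → ℝ), IsWeight w → char w ≤ K →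
      GaugeBound G (K + 1) w) (N : ℝ≥0 → ℝ≥0) :
    ∃ N' : ℝ≥0 → ℝ≥0, ∀ F : Set (((Fin n → ℝ) → ℝ≥0∞) × ((Fin n → ℝ) → ℝ≥0∞)),
      IsFamily F → NormIneq F p₀ (rhConst Φ) N → NormIneq F p char N' := by
  have hmaj := fun K : ℝ≥0 => exists_weight_majorant (n := n) hΦ hβ hσ hG hGlin
    (K := (K : ℝ) + 1) (by linarith [K.coe_nonneg])
  -- Constants are fixed for each `K` before any family appears, so the resulting `N'` does not
  -- depend on `F`.
  choose C K₁ hmaj using hmaj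
  refine ⟨fun K => N (K₁ K) * C K ^ ((p - p₀) / p / p₀), fun F hF hN K w hw hK fg hfg hfin => ?_⟩
  exact lpNorm_le_of_majorant hF hp₀ hp hN hw
    (hmaj K w hw (hchar K w hw hK)) (f := fg.1) (g := fg.2) hfg hfin

end RHExtrapolation

theorem mainTheorem1 (n : ℕ) (hn : 1 ≤ n) (p₀ q₀ : ℝ) (hp₀ : 0 < p₀) (hpq : p₀ ≤ q₀)
    (Ψ₀ : ℝ → ℝ)
    (hΨ₀ : p₀ < q₀ → RHExtrapolation.MemB (Real.conjExponent (q₀ / p₀)) Ψ₀)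
    (N : ℝ≥0 → ℝ≥0) :
    (∀ p : ℝ, p₀ < p → p < q₀ → ∀ Ψ : ℝ → ℝ,
      (∀ t : ℝ, 0 ≤ t →
        Ψ₀ t = Ψ (t ^ (Real.conjExponent (q₀ / p₀) / Real.conjExponent (q₀ / p)))) →
      ∃ N' : ℝ≥0 → ℝ≥0,
        ∀ F : Set (((Fin n → ℝ) → ℝ≥0∞) × ((Fin n → ℝ) → ℝ≥0∞)),
          RHExtrapolation.IsFamily F →
          (p₀ < q₀ → RHExtrapolation.NormIneq F p₀ (RHExtrapolation.rhConst Ψ₀) N) →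
          (p₀ = q₀ → RHExtrapolation.NormIneq F p₀ RHExtrapolation.rhInftyConst N) →
          RHExtrapolation.NormIneq F p (RHExtrapolation.rhConst Ψ) N') ∧
    (∃ N' : ℝ≥0 → ℝ≥0,
      ∀ F : Set (((Fin n → ℝ) → ℝ≥0∞) × ((Fin n → ℝ) → ℝ≥0∞)),
        RHExtrapolation.IsFamily F →
        (p₀ < q₀ → RHExtrapolation.NormIneq F p₀ (RHExtrapolation.rhConst Ψ₀) N) →
        (p₀ = q₀ → RHExtrapolation.NormIneq F p₀ RHExtrapolation.rhInftyConst N) →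
        RHExtrapolation.NormIneq F q₀ RHExtrapolation.rhInftyConst N') := by
  rcases hpq.eq_or_lt with rfl | hlt
  -- For `p₀ = q₀` the range in (a) is empty and (b) is the hypothesis itself.
  · exact ⟨fun p h1 h2 => absurd h1 h2.not_gt, N, fun F _ _ h => h rfl⟩
  have hq₀ : 0 < q₀ := hp₀.trans hlt
  have hΦ := hΨ₀ hlt
  have hd : 0 < q₀ - p₀ := sub_pos.2 hlt
  have hs : Real.conjExponent (q₀ / p₀) = q₀ / (q₀ - p₀) := by
    rw [Real.conjExponent]
    field_simp
  refine ⟨fun p hp hpq' Ψ hΨ => ?_, ?_⟩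
  · have hp0 : 0 < p := hp₀.trans hp
    have hd1 : 0 < q₀ - p := sub_pos.2 hpq'
    have hd2 : 0 < p - p₀ := sub_pos.2 hp
    have hr : Real.conjExponent (q₀ / p₀) / Real.conjExponent (q₀ / p) =
        (q₀ - p) / (q₀ - p₀) := by
      rw [hs, Real.conjExponent]
      field_simp
    rw [hr] at hΨ
    set r := (q₀ - p) / (q₀ - p₀) with hrdef
    have hr0 : 0 < r := by positivity
    have hr1 : r < 1 := (div_lt_one hd).2 (by linarith)
    have h1r : 1 - r = (p - p₀) / (q₀ - p₀) := by
      rw [hrdef]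
      field_simp
      ring
    have hmono : MonotoneOn Ψ (Ici 0) := by
      intro x hx y hy hxy
      have hinv : ∀ z : ℝ, 0 ≤ z → Ψ z = Ψ₀ (z ^ r⁻¹) := fun z hz => by
        rw [hΨ _ (by positivity), Real.rpow_inv_rpow hz hr0.ne']
      rw [mem_Ici] at hx hy
      rw [hinv x hx, hinv y hy]
      exact hΦ.young.mono (mem_Ici.2 (by positivity)) (mem_Ici.2 (by positivity))
        (Real.rpow_le_rpow hx hxy (by positivity))
    -- Here `β = (q₀ - p₀) / (p - p₀)`, `σ - 1 = p₀ / (p - p₀)` and `s - 1 = p₀ / (q₀ - p₀)`, whence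
    -- `σ - 1 = β (s - 1)`.
    obtain ⟨N', hN'⟩ := RHExtrapolation.exists_normIneq_of_gaugeBound (n := n) hp₀ hp hΦ
      (β := (1 - r)⁻¹) (inv_pos.2 (by linarith))
      (by rw [h1r, hs]; field_simp; ring)
      (fun x y hx hy => RHExtrapolation.ofReal_young_mul_le_add hΦ.young hr0 hr1 hΨ hx hy)
      (RHExtrapolation.exists_forall_ofReal_mul_le hΦ.young hr0 hr1 hΨ)
      (fun K w hw hK => RHExtrapolation.gaugeBound_of_rhConst_le hmono hw hK) N
    exact ⟨N', fun F hF h _ => hN' F hF (h hlt)⟩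
  -- At `p = q₀` the exponents `σ` and `s` coincide, so `β = 1`.
  · obtain ⟨N', hN'⟩ := RHExtrapolation.exists_normIneq_of_gaugeBound (n := n) hp₀ hlt hΦ
      one_pos (by rw [hs, one_mul])
      (fun x y hx hy => RHExtrapolation.ofReal_young_mul_le_inftyGauge hΦ.young hx hy)
      RHExtrapolation.exists_forall_ofReal_mul_le_inftyGauge
      (fun K w _ hK => RHExtrapolation.gaugeBound_of_rhInftyConst_le hK) N
    exact ⟨N', fun F hF h _ => hN' F hF (h hlt)⟩
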